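/- **Setting.** Fix a field $F$, a homology degree $d\ge 0$ and a real $p\ge 1$. For a finite metric space $S$ and $r\in\mathbb{R}$ let $\mathrm{VR}(S,r)$ be the simplicial complex of nonempty subsets of $S$ of diameter less than $r$. Let $D[S]$ be the persistence diagram of the persistence module $r\mapsto H_d(\mathrm{VR}(S,r);F)$, regarded as a measure on $\Omega=\{(x,y)\in\mathbb{R}^2: x<y\}$: the sum of Dirac masses at its points (birth, death) with finite death, counted with multiplicity. With $\overline\Omega=\{x\le y\}$, put for measures $\mu,\nu$ on $\Omega$ $$\mathrm{OT}_p(\mu,\nu)=\inf_{\Pi}\Big(\int_{\overline\Omega\times\overline\Omega}\|x-y\|_p^p\,d\Pi(x,y)\Big)^{1/p},$$ where $\Pi$ ranges over the Radon measures on $\overline\Omega\times\overline\Omega$ with $\Pi(P\times\overline\Omega)=\mu(P)$ and $\Pi(\overline\Omega\times Q)=\nu(Q)$ for all Borel $P,Q\subseteq\Omega$. A probability measure $\pi$ on a metric space $\mathcal X$ satisfies the $(a,b,r_0)$-standard assumption, where $a,b>0$ and $r_0\ge 0$, if $\pi(\mathcal B(x,r))\ge\min(1,ar^b)$ for all $x\in\mathcal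 X$ and $r>r_0$. **Theorem.** Let $N\in\mathbb{N}$. There are a constant $C_2$, depending only on $F,d,p,N$, and constants $C_3=C_3(a,b)$, depending only on $F,d,p,N,a,b$, and for every $m$ and every set $\mathcal X\subset\mathbb{R}^m$ of $N$ points there is a constant $C_1$, depending only on $F,d,p,\mathcal X$, such that the following holds. Let $\pi$ be a probability measure on $\mathcal X$ satisfying the $(a,b,r_0)$-standard assumption, let $n,B\ge 1$, let $S_n^{(1)},\dots,S_n^{(B)}$ be i.i.d. samples from $\pi^{\otimes n}$, and let $\bar D=\frac1B\sum_{i=1}^B D[S_n^{(i)}]$, where $S_n^{(i)}$ is viewed as the set of its points. Put $\beta=\frac pb-1$. Then $$\mathbb{E}\big[\mathrm{OT}_p^p(\bar D,D[\mathcal X])\big]\le C_1B^{-1/2}+C_2\,r_0^p+C_3\,\rho_n,$$ where $$\rho_n=\begin{cases} n^{-\beta} & \text{if } p>b,\\[2pt] \big(\frac{\log n}{n}\big)^{1/b} & \text{if } p\le b,\ n\ge 2,\ r_0<\big(\frac{\log n}{an}\big)^{1/b},\\[2pt] \big(\frac{\log n}{n}\big)^{p/b}\frac{1}{(\log n)^2}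 & \text{if } p\le b,\ n\ge 2,\ r_0\ge\big(\frac{\log n}{an}\big)^{1/b}.\end{cases}$$ -/

import Mathlib

open MeasureTheory ProbabilityTheory
open scoped ENNReal

noncomputable section

namespace MeanPersistence

/-! ### Simplicial homology -/

section Homology

variable (F : Type*) [Field F] {V : Type*}

/-- Ordered `d`-chains on the vertex set `V`: formal combinations of `(d+1)`-tuples of vertices. -/
abbrev Chain (V : Type*) (d : ℕ) : Type _ := (Fin (d + 1) → V) →₀ F

/-- The boundary `∂ (v₀, …, v_{d+1}) = ∑ᵢ (-1)ⁱ (v₀, …, v̂ᵢ, …, v_{d+1})`. -/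
def boundary (V : Type*) (d : ℕ) : Chain F V (d + 1) →ₗ[F] Chain F V d :=
  Finsupp.linearCombination F fun σ : Fin (d + 2) → V =>
    ∑ i : Fin (d + 2), (-1 : F) ^ (i : ℕ) • Finsupp.single (σ ∘ i.succAbove) (1 : F)

/-- The ordered `d`-simplices of a simplicial complex: tuples whose vertices span a face. -/
def orderedSimplices (K : PreAbstractSimplicialComplex V) (d : ℕ) : Set (Fin (d + 1) → V) :=
  {σ | ∃ s ∈ K.faces, (s : Set V) = Set.range σ}

/-- The ordered chains of a simplicial complex. -/
def chains (K : PreAbstractSimplicialComplex V) (d : ℕ) : Submodule F (Chain F V d) :=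
  Finsupp.supported F F (orderedSimplices K d)

/-- The `d`-cycles of a simplicial complex (unreduced: every `0`-chain is a cycle). -/
def cycles (K : PreAbstractSimplicialComplex V) : (d : ℕ) → Submodule F (Chain F V d)
  | 0 => chains F K 0
  | d + 1 => chains F K (d + 1) ⊓ LinearMap.ker (boundary F V d)

/-- The `d`-boundaries of a simplicial complex. -/
def boundaries (K : PreAbstractSimplicialComplex V) (d : ℕ) : Submodule F (Chain F V d) :=
  (chains F K (d + 1)).map (boundary F V d)

/-- The simplicial homology `H_d(K; F) = Z_d / B_d`, computed from the ordered chain complex and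
realized as the image of the cycles in the quotient of the chain space by the boundaries. -/
abbrev Homology (K : PreAbstractSimplicialComplex V) (d : ℕ) :
    Submodule F (Chain F V d ⧸ boundaries F K d) :=
  (cycles F K d).map (boundaries F K d).mkQ

variable {K L : PreAbstractSimplicialComplex V}

theorem chains_mono (h : K ≤ L) (d : ℕ) : chains F K d ≤ chains F L d :=
  Finsupp.supported_mono fun _ ⟨s, hs, e⟩ => ⟨s, h hs, e⟩

theorem cycles_mono (h : K ≤ L) : ∀ d : ℕ, cycles F K d ≤ cycles F L d
  | 0 => chains_mono F h 0
  | d + 1 => inf_le_inf_right _ (chains_mono F h (d + 1))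

theorem boundaries_mono (h : K ≤ L) (d : ℕ) : boundaries F K d ≤ boundaries F L d :=
  Submodule.map_mono (chains_mono F h (d + 1))

/-- The map `H_d(K) → H_d(L)` induced by an inclusion of complexes `K ≤ L`. -/
def homologyMap (h : K ≤ L) (d : ℕ) : Homology F K d →ₗ[F] Homology F L d :=
  (Submodule.factor (boundaries_mono F h d)).restrict (by
    rintro _ ⟨x, hx, rfl⟩
    exact ⟨x, cycles_mono F h d hx, rfl⟩)

end Homology

/-! ### Persistence diagrams of Vietoris–Rips filtrations -/

section Rips

/-- The Vietoris–Rips complex at scale `r`: nonempty finite sets of points of diameter less than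
`r`. -/
def ripsComplex (V : Type*) [MetricSpace V] (r : ℝ) : PreAbstractSimplicialComplex V where
  faces := {s | s.Nonempty ∧ Metric.diam (s : Set V) < r}
  isRelLowerSet_faces := fun s hs => ⟨hs.1, fun _ hts ht =>
    ⟨ht, (Metric.diam_mono (Finset.coe_subset.2 hts) s.finite_toSet.isBounded).trans_lt hs.2⟩⟩

theorem ripsComplex_mono (V : Type*) [MetricSpace V] {s t : ℝ} (h : s ≤ t) :
    ripsComplex V s ≤ ripsComplex V t :=
  fun _ hx => ⟨hx.1, hx.2.trans_le h⟩

variable (F : Type*) [Field F] (d : ℕ) (V : Type*) [MetricSpace V]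

/-- The persistent Betti number: the rank of `H_d(VR(V, s)) → H_d(VR(V, t))`, for `s ≤ t`. -/
def persistentBetti (s t : ℝ) : ℕ :=
  if h : s ≤ t then
    Module.finrank F (LinearMap.range (homologyMap F (ripsComplex_mono V h) d))
  else 0

/-- For `a < b < c < e`, the number of classes born between `a` and `b` and dying between `c` and
`e`, obtained from the persistent Betti numbers by inclusion and exclusion. -/
def rectangleCount (a b c e : ℝ) : ℤ :=
  (persistentBetti F d V b c - persistentBetti F d V a c : ℤ)
    - (persistentBetti F d V b e - persistentBetti F d V a e)

/-- The multiplicity of the point `(s, t)`, `s < t`, in the persistence diagram: the smallest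
number of classes counted by a rectangle around `(s, t)`. -/
def multiplicity (z : ℝ × ℝ) : ℕ :=
  sInf {k : ℕ | ∃ a b c e : ℝ, a < z.1 ∧ z.1 < b ∧ b < c ∧ c < z.2 ∧ z.2 < e ∧
    (k : ℤ) = rectangleCount F d V a b c e}

end Rips

/-- The open half-plane `Ω` above the diagonal. -/
def halfPlane : Set (ℝ × ℝ) := {z | z.1 < z.2}

/-- The closed half-plane `Ω ∪ ∂Ω`. -/
def closedHalfPlane : Set (ℝ × ℝ) := {z | z.1 ≤ z.2}

/-- The degree-`d` persistence diagram `D[S]` of the Vietoris–Rips filtration of a set of points,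
as a measure carried by `Ω`: the sum of the Dirac masses at its off-diagonal points, counted with
multiplicity. Classes that never die are not recorded. -/
def diagram (F : Type*) [Field F] (d : ℕ) {E : Type*} [MetricSpace E] (S : Set E) :
    Measure (ℝ × ℝ) :=
  Measure.sum fun z : halfPlane =>
    (multiplicity F d S (z : ℝ × ℝ) : ℝ≥0∞) • Measure.dirac (z : ℝ × ℝ)

/-! ### Optimal partial transport -/

/-- Admissible plans for the optimal partial transport between measures `μ`, `ν` on `Ω`: Radon
measures on `Ω̄ × Ω̄` whose marginals agree with `μ` and `ν` on the Borel subsets of `Ω`. -/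
structure IsPartialPlan (μ ν : Measure (ℝ × ℝ)) (γ : Measure ((ℝ × ℝ) × (ℝ × ℝ))) : Prop where
  locallyFinite : IsLocallyFiniteMeasure γ
  carried : γ (closedHalfPlane ×ˢ closedHalfPlane)ᶜ = 0
  left : ∀ P ⊆ halfPlane, MeasurableSet P → γ (P ×ˢ closedHalfPlane) = μ P
  right : ∀ Q ⊆ halfPlane, MeasurableSet Q → γ (closedHalfPlane ×ˢ Q) = ν Q

/-- The cost `‖x - y‖_p ^ p` on the plane with the `p`-norm. -/
def cost (p : ℝ) (x y : ℝ × ℝ) : ℝ := |x.1 - y.1| ^ p + |x.2 - y.2| ^ p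

/-- The optimal partial transport distance `OT_p`, with ground norm the `p`-norm. -/
def OT (p : ℝ) (μ ν : Measure (ℝ × ℝ)) : ℝ≥0∞ :=
  ⨅ (γ : Measure ((ℝ × ℝ) × (ℝ × ℝ))) (_ : IsPartialPlan μ ν γ),
    (∫⁻ w, ENNReal.ofReal (cost p w.1 w.2) ∂γ) ^ (1 / p)

/-! ### Sampling -/

/-- The `(a, b, r₀)`-standard assumption on a measure. -/
structure StandardAssumption {M : Type*} [PseudoMetricSpace M] [MeasurableSpace M]
    (π : Measure M) (a b r₀ : ℝ) : Prop where
  a_pos : 0 < a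
  b_pos : 0 < b
  r₀_nonneg : 0 ≤ r₀
  le_measure_ball : ∀ (x : M) (r : ℝ), r₀ < r →
    ENNReal.ofReal (min 1 (a * r ^ b)) ≤ π (Metric.ball x r)

/-- The mean persistence measure `D̄ = B⁻¹ ∑ᵢ D[Sᵢ]` of `B` samples of `n` points, where `D[Sᵢ]`
is the diagram of the set of points of the `i`-th sample. -/
def meanMeasure (F : Type*) [Field F] (d : ℕ) {E : Type*} [MetricSpace E] {B n : ℕ}
    (S : Fin B → Fin n → E) : Measure (ℝ × ℝ) :=
  (B : ℝ≥0∞)⁻¹ • ∑ i, diagram F d (Set.range (S i))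

/-- The approximation error `𝔼[OT_p(D̄, D[X]) ^ p]` for random samples `S` of points of `X`. -/
def approximationError (F : Type*) [Field F] (d : ℕ) (p : ℝ) {E : Type*} [MetricSpace E]
    (X : Finset E) {Ω : Type*} [MeasurableSpace Ω] (P : Measure Ω) {B n : ℕ}
    (S : Fin B → Ω → Fin n → X) : ℝ≥0∞ :=
  ∫⁻ ω, OT p (meanMeasure F d fun i j => (S i ω j : E)) (diagram F d (X : Set E)) ^ p ∂P

end MeanPersistence

end

/-!
Since `OT_p ^ p` is convex in its first argument, the error of the mean measure is at most the error
of a single sample, for every `B`; so `C₁ = 0` works.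

A sample `S` with covering radius `ε` is a retract of `X` under a map moving points by at most `ε`.
The retraction interleaves the two Rips filtrations, and at scales `s` for which no distance of `X`
lies in `[s, s + 2ε)` it identifies them up to contiguity. Cutting the axis at such scales groups
the finitely many distances into clusters of length `O(ε)`, and the two diagrams have the same
number of points in each product of two distinct clusters. Matching inside these boxes, and sending
the points near the diagonal to it, costs `O(ε ^ p)`.

The covering radius has the tail `N exp (-a n t ^ b)` beyond `r₀`, by a union bound over the points
of `X`, and integrating `p t ^ (p - 1)` against it gives the rates.
-/

noncomputable section

namespace MeanPersistence

/-! ### The prism operator -/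

section Prism

variable (R : Type*) [Ring R] {V W : Type*}

/-- The boundary of the augmented ordered chain complex. Here `n`-tuples of vertices sit in degree
`n - 1`, which makes the cone and prism formulas uniform in the degree; in nonnegative degrees this
is `boundary`. -/
def augBoundary (V : Type*) (n : ℕ) : ((Fin (n + 1) → V) →₀ R) →ₗ[R] ((Fin n → V) →₀ R) :=
  Finsupp.linearCombination R fun σ : Fin (n + 1) → V =>
    ∑ i : Fin (n + 1), (-1 : R) ^ (i : ℕ) • Finsupp.single (σ ∘ i.succAbove) (1 : R)

/-- The cone with apex `v` over a chain. -/
def cone (v : V) (n : ℕ) : ((Fin n → V) →₀ R) →ₗ[R] ((Fin (n + 1) → V) →₀ R) :=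
  Finsupp.lmapDomain R R fun σ => (Fin.cons v σ : Fin (n + 1) → V)

/-- The chain map induced by a map of vertices. -/
def push (f : V → W) (n : ℕ) : ((Fin n → V) →₀ R) →ₗ[R] ((Fin n → W) →₀ R) :=
  Finsupp.lmapDomain R R (f ∘ ·)

@[simp]
theorem cone_single (v : V) (n : ℕ) (σ : Fin n → V) (c : R) :
    cone R v n (Finsupp.single σ c) = Finsupp.single (Fin.cons v σ : Fin (n + 1) → V) c := by
  simp [cone]

@[simp]
theorem push_single (f : V → W) (n : ℕ) (σ : Fin n → V) (c : R) :
    push R f n (Finsupp.single σ c) = Finsupp.single (f ∘ σ) c := by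
  simp [push]

theorem push_id (n : ℕ) (x : (Fin n → V) →₀ R) : push R id n x = x :=
  LinearMap.congr_fun (Finsupp.lmapDomain_id R R) x

theorem push_push {U : Type*} (f : V → W) (g : W → U) (n : ℕ) (x : (Fin n → V) →₀ R) :
    push R g n (push R f n x) = push R (g ∘ f) n x :=
  (LinearMap.congr_fun (Finsupp.lmapDomain_comp R R (f ∘ ·) (g ∘ ·)) x).symm

theorem augBoundary_single (n : ℕ) (σ : Fin (n + 1) → V) :
    augBoundary R V n (Finsupp.single σ 1) =
      ∑ i : Fin (n + 1), (-1 : R) ^ (i : ℕ) • Finsupp.single (σ ∘ i.succAbove) (1 : R) := by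
  simp [augBoundary]

theorem cons_comp_succ_succAbove (n : ℕ) (v : V) (σ : Fin (n + 1) → V) (i : Fin (n + 1)) :
    (Fin.cons v σ : Fin (n + 2) → V) ∘ i.succ.succAbove = Fin.cons v (σ ∘ i.succAbove) := by
  funext j
  cases j using Fin.cases <;> simp

theorem augBoundary_cone_zero (v : V) (x : (Fin 0 → V) →₀ R) :
    augBoundary R V 0 (cone R v 0 x) = x := by
  suffices h : augBoundary R V 0 ∘ₗ cone R v 0 = LinearMap.id from LinearMap.congr_fun h x
  ext σ : 2
  simp [augBoundary_single, Subsingleton.elim _ σ]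

theorem augBoundary_cone_succ (v : V) (n : ℕ) (x : (Fin (n + 1) → V) →₀ R) :
    augBoundary R V (n + 1) (cone R v (n + 1) x) = x - cone R v n (augBoundary R V n x) := by
  suffices h : augBoundary R V (n + 1) ∘ₗ cone R v (n + 1) =
      LinearMap.id - cone R v n ∘ₗ augBoundary R V n from LinearMap.congr_fun h x
  ext σ : 2
  have face_zero : (Fin.cons v σ : Fin (n + 2) → V) ∘ Fin.succAbove 0 = σ := rfl
  simp only [LinearMap.comp_apply, Finsupp.lsingle_apply, cone_single, augBoundary_single,
    LinearMap.id_apply, LinearMap.sub_apply, map_sum, map_smul]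
  rw [Fin.sum_univ_succ, face_zero]
  simp only [cons_comp_succ_succAbove, Fin.val_succ, pow_succ, Fin.val_zero, pow_zero, one_smul,
    mul_neg, mul_one, neg_smul, Finset.sum_neg_distrib, ← sub_eq_add_neg]

theorem augBoundary_push (f : V → W) (n : ℕ) (x : (Fin (n + 1) → V) →₀ R) :
    augBoundary R W n (push R f (n + 1) x) = push R f n (augBoundary R V n x) := by
  suffices h : augBoundary R W n ∘ₗ push R f (n + 1) = push R f n ∘ₗ augBoundary R V n from
    LinearMap.congr_fun h x
  ext σ : 2
  simp only [LinearMap.comp_apply, Finsupp.lsingle_apply, push_single, augBoundary_single, map_sum,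
    map_smul, Function.comp_assoc]

theorem push_cone (f : V → W) (v : V) (n : ℕ) (x : (Fin n → V) →₀ R) :
    push R f (n + 1) (cone R v n x) = cone R (f v) n (push R f n x) := by
  suffices h : push R f (n + 1) ∘ₗ cone R v n = cone R (f v) n ∘ₗ push R f n from
    LinearMap.congr_fun h x
  ext σ : 2
  simp only [LinearMap.comp_apply, Finsupp.lsingle_apply, push_single, cone_single,
    Fin.comp_cons]

/-- The prism over an ordered simplex, with bottom its image under `f` and top its image under `g`:
the cone from `f (σ 0)` over the top and over the sides of the prism. -/
def prismSimplex (f g : V → W) : (n : ℕ) → (Fin n → V) → ((Fin (n + 1) → W) →₀ R)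
  | 0, _ => 0
  | n + 1, σ => cone R (f (σ 0)) (n + 1)
      (cone R (g (σ 0)) n (Finsupp.single (g ∘ Fin.tail σ) 1) - prismSimplex f g n (Fin.tail σ))

/-- The prism operator, a chain homotopy between the maps induced by `f` and `g`. -/
def prism (f g : V → W) (n : ℕ) : ((Fin n → V) →₀ R) →ₗ[R] ((Fin (n + 1) → W) →₀ R) :=
  Finsupp.linearCombination R (prismSimplex R f g n)

theorem prism_single (f g : V → W) (n : ℕ) (σ : Fin n → V) :
    prism R f g n (Finsupp.single σ 1) = prismSimplex R f g n σ := by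
  simp [prism]

theorem prism_zero (f g : V → W) : prism R f g 0 = 0 := by
  ext σ : 2
  simp [prism, prismSimplex]

theorem prism_cone (f g : V → W) (v : V) (n : ℕ) (x : (Fin n → V) →₀ R) :
    prism R f g (n + 1) (cone R v n x) =
      cone R (f v) (n + 1) (cone R (g v) n (push R g n x) - prism R f g n x) := by
  suffices h : prism R f g (n + 1) ∘ₗ cone R v n =
      cone R (f v) (n + 1) ∘ₗ (cone R (g v) n ∘ₗ push R g n - prism R f g n) from
    LinearMap.congr_fun h x
  ext σ : 2
  simp [prism_single, prismSimplex]

theorem linearMap_ext_cone {M : Type*} [AddCommMonoid M] [Module R M] {n : ℕ}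
    {φ ψ : ((Fin (n + 1) → V) →₀ R) →ₗ[R] M}
    (h : ∀ v x, φ (cone R v n x) = ψ (cone R v n x)) : φ = ψ := by
  ext σ : 2
  simpa using h (σ 0) (Finsupp.single (Fin.tail σ) 1)

theorem augBoundary_prism (f g : V → W) (n : ℕ) (x : (Fin (n + 1) → V) →₀ R) :
    augBoundary R W (n + 1) (prism R f g (n + 1) x) + prism R f g n (augBoundary R V n x) =
      push R g (n + 1) x - push R f (n + 1) x := by
  suffices h : augBoundary R W (n + 1) ∘ₗ prism R f g (n + 1) + prism R f g n ∘ₗ augBoundary R V n =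
      push R g (n + 1) - push R f (n + 1) from LinearMap.congr_fun h x
  clear x
  induction n with
  | zero =>
    refine linearMap_ext_cone R fun v x => ?_
    have push_eq : push R g 0 = push R f 0 := by
      ext σ : 2
      simp [Subsingleton.elim (g ∘ σ) (f ∘ σ)]
    simp [prism_cone, prism_zero, augBoundary_cone_succ, push_cone, augBoundary_cone_zero, push_eq]
  | succ n ih =>
    refine linearMap_ext_cone R fun v x => ?_
    have hx : augBoundary R W (n + 1) (prism R f g (n + 1) x) =
        push R g (n + 1) x - push R f (n + 1) x - prism R f g n (augBoundary R V n x) :=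
      eq_sub_of_add_eq (LinearMap.congr_fun ih x)
    simp only [LinearMap.add_apply, LinearMap.comp_apply, LinearMap.sub_apply, prism_cone,
      augBoundary_cone_succ, map_sub, augBoundary_push, hx, push_cone]
    abel

end Prism

/-! ### Contiguity -/

section Contiguity

theorem map_mem_of_mem_supported {R α M : Type*} [Ring R] [AddCommGroup M] [Module R M]
    {φ : (α →₀ R) →ₗ[R] M} {s : Set α} {P : Submodule R M}
    (h : ∀ a ∈ s, φ (Finsupp.single a 1) ∈ P) {x : α →₀ R} (hx : x ∈ Finsupp.supported R R s) :
    φ x ∈ P := by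
  suffices H : Finsupp.supported R R s ≤ P.comap φ from H hx
  rw [Finsupp.supported_eq_span_single, Submodule.span_le]
  rintro _ ⟨a, ha, rfl⟩
  exact h a ha

theorem cone_mem_supported {R V : Type*} [Ring R] {v : V} {n : ℕ} {A : Set V} (hv : v ∈ A)
    {x : (Fin n → V) →₀ R}
    (hx : x ∈ Finsupp.supported R R {σ : Fin n → V | Set.range σ ⊆ A}) :
    cone R v n x ∈ Finsupp.supported R R {σ : Fin (n + 1) → V | Set.range σ ⊆ A} := by
  refine map_mem_of_mem_supported (fun σ hσ => ?_) hx
  rw [cone_single]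
  refine Finsupp.single_mem_supported R _ ?_
  rw [Set.mem_ofPred_eq, Fin.range_cons]
  exact Set.insert_subset hv hσ

theorem prismSimplex_mem_supported {R V W : Type*} [Ring R] {f g : V → W} {n : ℕ} {σ : Fin n → V}
    {A : Set W} (hf : ∀ j, f (σ j) ∈ A) (hg : ∀ j, g (σ j) ∈ A) :
    prismSimplex R f g n σ ∈ Finsupp.supported R R {τ : Fin (n + 1) → W | Set.range τ ⊆ A} := by
  induction n with
  | zero => exact Submodule.zero_mem _
  | succ n ih =>
    have top_mem : Finsupp.single (g ∘ Fin.tail σ) (1 : R) ∈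
        Finsupp.supported R R {τ : Fin n → W | Set.range τ ⊆ A} :=
      Finsupp.single_mem_supported R _ (Set.range_subset_iff.2 fun j => hg j.succ)
    exact cone_mem_supported (hf 0) (sub_mem (cone_mem_supported (hg 0) top_mem)
      (ih (fun j => hf j.succ) fun j => hg j.succ))

variable {F : Type*} [Field F] {V W : Type*} {K : PreAbstractSimplicialComplex V}
  {L : PreAbstractSimplicialComplex W} {f g : V → W} {d : ℕ}

/-- The vertex map `f` carries the faces of `K` to faces of `L`. -/
def IsSimplicialMap (K : PreAbstractSimplicialComplex V) (L : PreAbstractSimplicialComplex W)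
    (f : V → W) : Prop :=
  ∀ s ∈ K.faces, ∃ t ∈ L.faces, (t : Set W) = f '' s

/-- The vertex maps `f` and `g` are contiguous as maps from `K` to `L`: the images of a face of `K`
under `f` and `g` together span a face of `L`. -/
def Contiguous (K : PreAbstractSimplicialComplex V) (L : PreAbstractSimplicialComplex W)
    (f g : V → W) : Prop :=
  ∀ s ∈ K.faces, ∃ t ∈ L.faces, (t : Set W) = f '' s ∪ g '' s

theorem mem_orderedSimplices_of_range_subset {t : Finset V} (ht : t ∈ K.faces)
    {τ : Fin (d + 1) → V} (hτ : Set.range τ ⊆ t) : τ ∈ orderedSimplices K d := by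
  classical
  have range_eq : ((Finset.univ.image τ : Finset V) : Set V) = Set.range τ := by simp
  refine ⟨Finset.univ.image τ, (K.isRelLowerSet_faces ht).2 ?_ (Finset.univ_nonempty.image τ),
    range_eq⟩
  exact Finset.coe_subset.1 (range_eq ▸ hτ)

theorem cycles_le_chains (K : PreAbstractSimplicialComplex V) :
    ∀ d : ℕ, cycles F K d ≤ chains F K d
  | 0 => le_rfl
  | _ + 1 => inf_le_left

theorem push_mem_chains (h : IsSimplicialMap K L f) {x : Chain F V d} (hx : x ∈ chains F K d) :
    push F f (d + 1) x ∈ chains F L d := by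
  refine map_mem_of_mem_supported ?_ hx
  rintro σ ⟨s, hs, range_eq⟩
  obtain ⟨t, ht, image_eq⟩ := h s hs
  rw [push_single]
  exact Finsupp.single_mem_supported F _ ⟨t, ht, by rw [image_eq, range_eq, Set.range_comp]⟩

theorem push_mem_cycles (h : IsSimplicialMap K L f) {x : Chain F V d} (hx : x ∈ cycles F K d) :
    push F f (d + 1) x ∈ cycles F L d := by
  cases d with
  | zero => exact push_mem_chains h hx
  | succ d =>
    have boundary_eq : augBoundary F V (d + 1) x = 0 := hx.2
    refine ⟨push_mem_chains h hx.1, ?_⟩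
    change augBoundary F W (d + 1) (push F f (d + 1 + 1) x) = 0
    rw [augBoundary_push, boundary_eq, map_zero]

theorem push_mem_boundaries (h : IsSimplicialMap K L f) {x : Chain F V d}
    (hx : x ∈ boundaries F K d) : push F f (d + 1) x ∈ boundaries F L d := by
  obtain ⟨y, hy, rfl⟩ := hx
  exact ⟨push F f (d + 2) y, push_mem_chains h hy, augBoundary_push F f (d + 1) y⟩

theorem prism_mem_chains (h : Contiguous K L f g) {x : Chain F V d} (hx : x ∈ chains F K d) :
    prism F f g (d + 1) x ∈ chains F L (d + 1) := by
  refine map_mem_of_mem_supported ?_ hx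
  rintro σ ⟨s, hs, range_eq⟩
  obtain ⟨t, ht, image_eq⟩ := h s hs
  have hσ (j) : σ j ∈ (s : Set V) := range_eq ▸ Set.mem_range_self j
  rw [prism_single]
  refine Finsupp.supported_mono (fun τ => mem_orderedSimplices_of_range_subset ht)
    (prismSimplex_mem_supported (fun j => ?_) fun j => ?_)
  · exact image_eq ▸ Or.inl (Set.mem_image_of_mem f (hσ j))
  · exact image_eq ▸ Or.inr (Set.mem_image_of_mem g (hσ j))

theorem prism_augBoundary_eq_zero {x : Chain F V d} (hx : x ∈ cycles F K d) :
    prism F f g d (augBoundary F V d x) = 0 := by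
  cases d with
  | zero => rw [prism_zero, LinearMap.zero_apply]
  | succ d =>
    have boundary_eq : augBoundary F V (d + 1) x = 0 := hx.2
    rw [boundary_eq, map_zero]

theorem push_sub_push_mem_boundaries (h : Contiguous K L f g) {x : Chain F V d}
    (hx : x ∈ cycles F K d) : push F g (d + 1) x - push F f (d + 1) x ∈ boundaries F L d := by
  refine ⟨prism F f g (d + 1) x, prism_mem_chains h (cycles_le_chains K d hx), ?_⟩
  have homotopy := augBoundary_prism F f g d x
  rwa [prism_augBoundary_eq_zero hx, add_zero] at homotopy

end Contiguity

/-! ### Persistent Betti numbers -/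

section LinearAlgebra

variable {K M : Type*} [Field K] [AddCommGroup M] [Module K M]

theorem finrank_map_subtype (P : Submodule K M) (Q : Submodule K P) :
    Module.finrank K (Q.map P.subtype) = Module.finrank K Q :=
  (LinearEquiv.finrank_eq (Submodule.equivMapOfInjective _ P.subtype_injective Q)).symm

theorem finrank_map_mkQ_add_finrank_inf [FiniteDimensional K M] (Z B : Submodule K M) :
    Module.finrank K (Z.map B.mkQ) + Module.finrank K (Z ⊓ B : Submodule K M) =
      Module.finrank K Z := by
  have rank_nullity := LinearMap.finrank_range_add_finrank_ker (B.mkQ.domRestrict Z)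
  rwa [LinearMap.range_domRestrict, LinearMap.ker_domRestrict, Submodule.ker_mkQ,
    ← finrank_map_subtype, Submodule.map_comap_subtype] at rank_nullity

theorem finrank_inf_add_finrank_inf_le [FiniteDimensional K M] {Z Z' B B' : Submodule K M}
    (hZ : Z ≤ Z') (hB : B ≤ B') :
    Module.finrank K (Z ⊓ B' : Submodule K M) + Module.finrank K (Z' ⊓ B : Submodule K M) ≤
      Module.finrank K (Z' ⊓ B' : Submodule K M) + Module.finrank K (Z ⊓ B : Submodule K M) := by
  have modular := Submodule.finrank_sup_add_finrank_inf_eq (Z ⊓ B') (Z' ⊓ B)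
  rw [inf_inf_inf_comm, inf_eq_left.2 hZ, inf_eq_right.2 hB] at modular
  have sup_le : Module.finrank K ((Z ⊓ B') ⊔ (Z' ⊓ B) : Submodule K M) ≤
      Module.finrank K (Z' ⊓ B' : Submodule K M) :=
    Submodule.finrank_mono (sup_le (inf_le_inf_right _ hZ) (inf_le_inf_left _ hB))
  omega

theorem finrank_map_mkQ_le {M' : Type*} [AddCommGroup M'] [Module K M'] [FiniteDimensional K M']
    {Z B : Submodule K M} {Z' B' : Submodule K M'} (g : M' →ₗ[K] M) (hB : B' ≤ B.comap g)
    (hZ : ∀ z ∈ Z, ∃ z' ∈ Z', g z' - z ∈ B) :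
    Module.finrank K (Z.map B.mkQ) ≤ Module.finrank K (Z'.map B'.mkQ) := by
  have map_le : Z.map B.mkQ ≤ (Z'.map B'.mkQ).map (B'.mapQ B g hB) := by
    rintro _ ⟨z, hz, rfl⟩
    obtain ⟨z', hz', hsub⟩ := hZ z hz
    exact ⟨_, ⟨z', hz', rfl⟩, (Submodule.Quotient.eq B).2 hsub⟩
  exact (Submodule.finrank_mono map_le).trans (Submodule.finrank_map_le _ _)

end LinearAlgebra

section Betti

variable (F : Type*) [Field F] (d : ℕ) {V : Type*} [MetricSpace V]

theorem persistentBetti_eq_finrank_map {s t : ℝ} (h : s ≤ t) :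
    persistentBetti F d V s t =
      Module.finrank F ((cycles F (ripsComplex V s) d).map
        (boundaries F (ripsComplex V t) d).mkQ) := by
  have map_range : (LinearMap.range (homologyMap F (ripsComplex_mono V h) d)).map
      (Homology F (ripsComplex V t) d).subtype =
      (cycles F (ripsComplex V s) d).map (boundaries F (ripsComplex V t) d).mkQ := by
    ext y
    constructor
    · rintro ⟨_, ⟨⟨_, ⟨x, hx, rfl⟩⟩, rfl⟩, rfl⟩
      exact ⟨x, hx, rfl⟩
    · rintro ⟨x, hx, rfl⟩
      exact ⟨_, ⟨⟨_, ⟨x, hx, rfl⟩⟩, rfl⟩, rfl⟩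
  rw [persistentBetti, dif_pos h, ← map_range, finrank_map_subtype]

theorem persistentBetti_congr {s s' t t' : ℝ} (h : s ≤ t) (h' : s' ≤ t')
    (hs : ripsComplex V s = ripsComplex V s') (ht : ripsComplex V t = ripsComplex V t') :
    persistentBetti F d V s t = persistentBetti F d V s' t' := by
  rw [persistentBetti_eq_finrank_map F d h, persistentBetti_eq_finrank_map F d h', hs, ht]

theorem rectangleCount_congr {a b c e a' b' c' e' : ℝ} (hab : a ≤ b) (hbc : b ≤ c) (hce : c ≤ e)
    (hab' : a' ≤ b') (hbc' : b' ≤ c') (hce' : c' ≤ e')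
    (ha : ripsComplex V a = ripsComplex V a') (hb : ripsComplex V b = ripsComplex V b')
    (hc : ripsComplex V c = ripsComplex V c') (he : ripsComplex V e = ripsComplex V e') :
    rectangleCount F d V a b c e = rectangleCount F d V a' b' c' e' := by
  unfold rectangleCount
  rw [persistentBetti_congr F d hbc hbc' hb hc,
    persistentBetti_congr F d (hab.trans hbc) (hab'.trans hbc') ha hc,
    persistentBetti_congr F d (hbc.trans hce) (hbc'.trans hce') hb he,
    persistentBetti_congr F d (hab.trans (hbc.trans hce)) (hab'.trans (hbc'.trans hce')) ha he]

theorem rectangleCount_self_left (a c e : ℝ) : rectangleCount F d V a a c e = 0 := by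
  simp [rectangleCount]

theorem rectangleCount_self_right (a b c : ℝ) : rectangleCount F d V a b c c = 0 := by
  simp [rectangleCount]

theorem rectangleCount_sub_left (a m b c e : ℝ) :
    rectangleCount F d V a b c e - rectangleCount F d V a m c e =
      rectangleCount F d V m b c e := by
  unfold rectangleCount
  ring

theorem rectangleCount_sub_right (a b c m e : ℝ) :
    rectangleCount F d V a b c e - rectangleCount F d V a b c m =
      rectangleCount F d V a b m e := by
  unfold rectangleCount
  ring

variable [Finite V]

theorem persistentBetti_add_finrank_inf {s t : ℝ} (h : s ≤ t) :
    persistentBetti F d V s t + Module.finrank F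
      (cycles F (ripsComplex V s) d ⊓ boundaries F (ripsComplex V t) d :
        Submodule F (Chain F V d)) =
      Module.finrank F (cycles F (ripsComplex V s) d) := by
  rw [persistentBetti_eq_finrank_map F d h]
  exact finrank_map_mkQ_add_finrank_inf _ _

theorem persistentBetti_le_card (s t : ℝ) :
    persistentBetti F d V s t ≤ Nat.card V ^ (d + 1) := by
  by_cases h : s ≤ t
  · calc persistentBetti F d V s t
        ≤ Module.finrank F (cycles F (ripsComplex V s) d) :=
          (Nat.le_add_right _ _).trans_eq (persistentBetti_add_finrank_inf F d h)
      _ ≤ Module.finrank F (Chain F V d) := Submodule.finrank_le _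
      _ = Nat.card V ^ (d + 1) := by
          have := Fintype.ofFinite V
          simp [Module.finrank_finsupp_self]
  · simp [persistentBetti, h]

theorem rectangleCount_nonneg {a b c e : ℝ} (hab : a ≤ b) (hbc : b ≤ c) (hce : c ≤ e) :
    0 ≤ rectangleCount F d V a b c e := by
  have h_bc := persistentBetti_add_finrank_inf F d (V := V) hbc
  have h_ac := persistentBetti_add_finrank_inf F d (V := V) (hab.trans hbc)
  have h_be := persistentBetti_add_finrank_inf F d (V := V) (hbc.trans hce)
  have h_ae := persistentBetti_add_finrank_inf F d (V := V) (hab.trans (hbc.trans hce))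
  have exchange := finrank_inf_add_finrank_inf_le (cycles_mono F (ripsComplex_mono V hab) d)
    (boundaries_mono F (ripsComplex_mono V hce) d)
  unfold rectangleCount
  omega

theorem rectangleCount_mono {a a' b b' c c' e e' : ℝ} (haa' : a ≤ a') (hab' : a' ≤ b')
    (hbb' : b' ≤ b) (hbc : b ≤ c) (hcc' : c ≤ c') (hce' : c' ≤ e') (hee' : e' ≤ e) :
    rectangleCount F d V a' b' c' e' ≤ rectangleCount F d V a b c e := by
  have hab := haa'.trans (hab'.trans hbb')
  have hbc' := hbc.trans hcc'
  have h_low := rectangleCount_nonneg F d (V := V) hab hbc hcc'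
  have h_high := rectangleCount_nonneg F d (V := V) hab (hbc'.trans hce') hee'
  have h_left := rectangleCount_nonneg F d (V := V) haa' (hab'.trans (hbb'.trans hbc')) hce'
  have h_right := rectangleCount_nonneg F d (V := V) hbb' hbc' hce'
  unfold rectangleCount at *
  omega

theorem rectangleCount_le (a b c e : ℝ) :
    rectangleCount F d V a b c e ≤ 2 * Nat.card V ^ (d + 1) := by
  have h_bc : (persistentBetti F d V b c : ℤ) ≤ Nat.card V ^ (d + 1) :=
    mod_cast persistentBetti_le_card F d b c
  have h_ae : (persistentBetti F d V a e : ℤ) ≤ Nat.card V ^ (d + 1) :=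
    mod_cast persistentBetti_le_card F d a e
  unfold rectangleCount
  omega

end Betti

section Rips

variable {V W : Type*} [MetricSpace V] [MetricSpace W]

theorem exists_dist_eq_diam {s : Finset V} (hs : s.Nonempty) :
    ∃ x ∈ s, ∃ y ∈ s, dist x y = Metric.diam (s : Set V) := by
  obtain ⟨z, hz, hmax⟩ := (s ×ˢ s).exists_max_image (fun z => dist z.1 z.2) (hs.product hs)
  rw [Finset.mem_product] at hz
  refine ⟨z.1, hz.1, z.2, hz.2, le_antisymm
    (Metric.dist_le_diam_of_mem s.finite_toSet.isBounded hz.1 hz.2) ?_⟩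
  exact Metric.diam_le_of_forall_dist_le dist_nonneg fun x hx y hy =>
    hmax (x, y) (Finset.mem_product.2 ⟨hx, hy⟩)

theorem ripsComplex_eq {s t : ℝ} (hst : s ≤ t) (h : ∀ x y : V, dist x y ∉ Set.Ico s t) :
    ripsComplex V s = ripsComplex V t := by
  refine le_antisymm (ripsComplex_mono V hst) fun σ hσ => ⟨hσ.1, ?_⟩
  obtain ⟨x, -, y, -, dist_eq⟩ := exists_dist_eq_diam hσ.1
  by_contra hs
  exact h x y ⟨dist_eq ▸ not_lt.1 hs, dist_eq ▸ hσ.2⟩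

theorem mem_ripsComplex_of_forall_exists_dist_le {σ : Finset V} {τ : Finset W} {s η : ℝ}
    (hσ : σ ∈ (ripsComplex V s).faces) (hτ : τ.Nonempty)
    (h : ∀ u ∈ τ, ∀ v ∈ τ, ∃ x ∈ σ, ∃ y ∈ σ, dist u v ≤ dist x y + η) :
    τ ∈ (ripsComplex W (s + η)).faces := by
  refine ⟨hτ, ?_⟩
  obtain ⟨u, hu, v, hv, diam_eq⟩ := exists_dist_eq_diam hτ
  obtain ⟨x, hx, y, hy, dist_le⟩ := h u hu v hv
  calc Metric.diam (τ : Set W) ≤ dist x y + η := diam_eq ▸ dist_le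
    _ ≤ Metric.diam (σ : Set V) + η := by
        gcongr
        exact Metric.dist_le_diam_of_mem σ.finite_toSet.isBounded hx hy
    _ < s + η := by
        gcongr
        exact hσ.2

theorem isSimplicialMap_ripsComplex {f : V → W} {η : ℝ}
    (hf : ∀ x y, dist (f x) (f y) ≤ dist x y + η) (s : ℝ) :
    IsSimplicialMap (ripsComplex V s) (ripsComplex W (s + η)) f := by
  classical
  intro σ hσ
  refine ⟨σ.image f, mem_ripsComplex_of_forall_exists_dist_le hσ (hσ.1.image f) ?_,
    Finset.coe_image⟩
  intro u hu v hv
  obtain ⟨x, hx, rfl⟩ := Finset.mem_image.1 hu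
  obtain ⟨y, hy, rfl⟩ := Finset.mem_image.1 hv
  exact ⟨x, hx, y, hy, hf x y⟩

theorem contiguous_id_ripsComplex {f : W → W} {ε : ℝ} (hε : 0 ≤ ε) (hf : ∀ x, dist (f x) x ≤ ε)
    (s : ℝ) : Contiguous (ripsComplex W s) (ripsComplex W (s + 2 * ε)) id f := by
  classical
  intro σ hσ
  have near : ∀ u ∈ σ ∪ σ.image f, ∃ x ∈ σ, dist u x ≤ ε := by
    intro u hu
    rcases Finset.mem_union.1 hu with hu | hu
    · exact ⟨u, hu, (dist_self u).trans_le hε⟩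
    · obtain ⟨x, hx, rfl⟩ := Finset.mem_image.1 hu
      exact ⟨x, hx, hf x⟩
  refine ⟨σ ∪ σ.image f, mem_ripsComplex_of_forall_exists_dist_le hσ
    (hσ.1.mono Finset.subset_union_left) ?_, by simp⟩
  intro u hu v hv
  obtain ⟨x, hx, hux⟩ := near u hu
  obtain ⟨y, hy, hvy⟩ := near v hv
  refine ⟨x, hx, y, hy, ?_⟩
  linarith [dist_triangle4_right u v x y]

variable (F : Type*) [Field F] (d : ℕ)

-- Both homologies surject onto each other's images: `φ` retracts `V ⊆ W` up to the scale shift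
-- `2 * ε`, which is invisible at `s` and `t`, and `i ∘ φ` is contiguous to the identity of `W`.
theorem persistentBetti_eq_of_retraction [Finite V] [Finite W] {i : V → W} (hi : Isometry i)
    {φ : W → V} (hφ : Function.LeftInverse φ i) {ε : ℝ} (hε : 0 ≤ ε)
    (hdist : ∀ w, dist (i (φ w)) w ≤ ε) {s t : ℝ} (hst : s ≤ t)
    (hWs : ripsComplex W s = ripsComplex W (s + 2 * ε))
    (hVs : ripsComplex V s = ripsComplex V (s + 2 * ε))
    (hVt : ripsComplex V t = ripsComplex V (t + 2 * ε)) :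
    persistentBetti F d V s t = persistentBetti F d W s t := by
  have simplicial_i (r : ℝ) : IsSimplicialMap (ripsComplex V r) (ripsComplex W r) i := by
    simpa using isSimplicialMap_ripsComplex (η := 0) (fun x y => by simp [hi.dist_eq]) r
  have simplicial_φ (r : ℝ) : IsSimplicialMap (ripsComplex W r) (ripsComplex V (r + 2 * ε)) φ :=
    isSimplicialMap_ripsComplex (fun x y => by
      have := dist_triangle4 (i (φ x)) x y (i (φ y))
      rw [← hi.dist_eq]
      linarith [hdist x, dist_comm y (i (φ y)), hdist y]) r
  rw [persistentBetti_eq_finrank_map F d hst, persistentBetti_eq_finrank_map F d hst]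
  apply le_antisymm
  · refine finrank_map_mkQ_le (push F φ (d + 1)) (fun x hx => ?_) fun x hx =>
      ⟨push F i (d + 1) x, push_mem_cycles (simplicial_i s) hx, ?_⟩
    · rw [hVt]
      exact push_mem_boundaries (simplicial_φ t) hx
    · rw [push_push, hφ.comp_eq_id, push_id, sub_self]
      exact Submodule.zero_mem _
  · refine finrank_map_mkQ_le (push F i (d + 1))
      (fun x hx => push_mem_boundaries (simplicial_i t) hx) fun x hx =>
      ⟨push F φ (d + 1) x, hVs ▸ push_mem_cycles (simplicial_φ s) hx, ?_⟩
    have homologous := push_sub_push_mem_boundaries (contiguous_id_ripsComplex hε hdist s) hx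
    rw [← hWs, push_id] at homologous
    rw [push_push]
    exact boundaries_mono F (ripsComplex_mono W hst) d homologous

end Rips

/-! ### Multiplicities -/

section Gap

/-- Distinct points of `T` are more than `2 * δ` apart, so that a window of size `δ` on either side
of a point of `T` meets no other window. -/
structure IsGap (T : Finset ℝ) (δ : ℝ) : Prop where
  pos : 0 < δ
  add_lt : ∀ u ∈ T, ∀ v ∈ T, u < v → u + 2 * δ < v

theorem exists_isGap (T : Finset ℝ) : ∃ δ : ℝ, IsGap T δ := by
  have eventually_add_lt : ∀ᶠ δ : ℝ in nhdsWithin 0 (Set.Ioi 0),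
      ∀ u ∈ T, ∀ v ∈ T, u < v → u + 2 * δ < v := by
    simp only [Filter.eventually_all_finset]
    intro u _ v _
    by_cases huv : u < v
    · have tendsto : Filter.Tendsto (fun δ : ℝ => u + 2 * δ) (nhds 0) (nhds u) :=
        Continuous.tendsto' (by fun_prop) 0 u (by simp)
      filter_upwards [nhdsWithin_le_nhds (tendsto.eventually_lt_const huv)] with δ hδ _ using hδ
    · exact Filter.Eventually.of_forall fun δ h => absurd h huv
  obtain ⟨δ, add_lt, pos⟩ := (eventually_add_lt.and self_mem_nhdsWithin).exists
  exact ⟨δ, pos, add_lt⟩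

theorem sum_jumps {G : Type*} [AddCommGroup G] {g : ℝ → G} {δ : ℝ} (hδ : 0 < δ) {S : Finset ℝ}
    {a b : ℝ} (hab : a ≤ b) (hS : ∀ x ∈ S, a ≤ x ∧ x + δ ≤ b)
    (hsep : ∀ x ∈ S, ∀ y ∈ S, x < y → x + δ ≤ y)
    (hg : ∀ s t, a ≤ s → s ≤ t → t ≤ b → (∀ x ∈ S, x ∉ Set.Ico s t) → g s = g t) :
    ∑ x ∈ S, (g (x + δ) - g x) = g b - g a := by
  induction S using Finset.induction_on_max generalizing b with
  | empty => simp [hg a b le_rfl hab le_rfl (by simp)]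
  | insert m S hm ih =>
    simp only [Finset.mem_insert, forall_eq_or_imp] at hS hsep hg
    obtain ⟨⟨ham, hmb⟩, hS⟩ := hS
    have below : ∑ x ∈ S, (g (x + δ) - g x) = g m - g a :=
      ih ham (fun x hx => ⟨(hS x hx).1, (hsep.2 x hx).1 (hm x hx)⟩)
        (fun x hx y hy => (hsep.2 x hx).2 y hy)
        fun s t has hst htm hs => hg s t has hst (by linarith) ⟨fun h => h.2.not_ge htm, hs⟩
    have above : g (m + δ) = g b :=
      hg _ _ (by linarith) hmb le_rfl ⟨fun h => by linarith [h.1],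
        fun x hx h => by linarith [h.1, hm x hx]⟩
    rw [Finset.sum_insert fun h => (hm m h).false, below, above]
    abel

end Gap

section Multiplicity

/-- The finite set of pairwise distances of a finite metric space, where its Rips complexes can
change. -/
def distances (V : Type*) [MetricSpace V] [Finite V] : Finset ℝ :=
  (Set.finite_range fun z : V × V => dist z.1 z.2).toFinset

variable (F : Type*) [Field F] (d : ℕ) {V : Type*} [MetricSpace V] [Finite V] {T : Finset ℝ}
  {δ : ℝ}

theorem mem_distances {r : ℝ} : r ∈ distances V ↔ ∃ u v : V, dist u v = r := by
  simp [distances]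

theorem dist_mem_distances (u v : V) : dist u v ∈ distances V :=
  mem_distances.2 ⟨u, v, rfl⟩

theorem card_distances_le : (distances V).card ≤ Nat.card V ^ 2 := by
  rw [distances, ← Set.ncard_eq_toFinset_card _ (Set.finite_range _), sq, ← Nat.card_prod]
  exact Finite.card_range_le _

theorem ripsComplex_eq_of_disjoint (hT : distances V ⊆ T) {s t : ℝ} (hst : s ≤ t)
    (h : ∀ x ∈ T, x ∉ Set.Ico s t) : ripsComplex V s = ripsComplex V t :=
  ripsComplex_eq hst fun u v => h _ (hT (dist_mem_distances u v))

theorem ripsComplex_sub_eq (hT : distances V ⊆ T) (hδ : IsGap T δ) {x η : ℝ} (hx : x ∈ T)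
    (h0 : 0 < η) (hη : η ≤ δ) : ripsComplex V (x - η) = ripsComplex V x := by
  refine ripsComplex_eq_of_disjoint hT (by linarith) fun u hu h => ?_
  linarith [hδ.add_lt u hu x hx h.2, h.1]

theorem ripsComplex_add_eq (hT : distances V ⊆ T) (hδ : IsGap T δ) {x η : ℝ} (hx : x ∈ T)
    (h0 : 0 < η) (hη : η ≤ δ) : ripsComplex V (x + η) = ripsComplex V (x + δ) := by
  refine ripsComplex_eq_of_disjoint hT (by linarith) fun u hu h => ?_
  linarith [hδ.add_lt x hx u hu (by linarith [h.1]), h.2, hδ.pos]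

theorem rectangleCount_small_eq (hT : distances V ⊆ T) (hδ : IsGap T δ) {x y η : ℝ} (hx : x ∈ T)
    (hy : y ∈ T) (hxy : x < y) (h0 : 0 < η) (hη : η ≤ δ) :
    rectangleCount F d V (x - η) (x + η) (y - η) (y + η) =
      rectangleCount F d V x (x + δ) y (y + δ) := by
  have gap := hδ.add_lt x hx y hy hxy
  exact rectangleCount_congr F d (by linarith) (by linarith) (by linarith) (by linarith)
    (by linarith) (by linarith) (ripsComplex_sub_eq hT hδ hx h0 hη)
    (ripsComplex_add_eq hT hδ hx h0 hη) (ripsComplex_sub_eq hT hδ hy h0 hη)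
    (ripsComplex_add_eq hT hδ hy h0 hη)

theorem multiplicity_eq (hT : distances V ⊆ T) (hδ : IsGap T δ) {x y : ℝ} (hx : x ∈ T)
    (hy : y ∈ T) (hxy : x < y) :
    (multiplicity F d V (x, y) : ℤ) = rectangleCount F d V x (x + δ) y (y + δ) := by
  have gap := hδ.add_lt x hx y hy hxy
  have pos := hδ.pos
  obtain ⟨k, hk⟩ := Int.eq_ofNat_of_zero_le
    (rectangleCount_nonneg F d (V := V) (a := x) (b := x + δ) (c := y) (e := y + δ)
      (by linarith) (by linarith) (by linarith))
  rw [hk, Nat.cast_inj]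
  refine IsLeast.csInf_eq ⟨⟨x - δ, x + δ, y - δ, y + δ, by simpa, by simpa, by linarith, by simpa,
    by simpa, by rw [rectangleCount_small_eq F d hT hδ hx hy hxy pos le_rfl, hk]⟩, ?_⟩
  rintro m ⟨a, b, c, e, hax, hxb, hbc, hcy, hye, hm⟩
  obtain ⟨η, h0, hηδ, hηa, hηb, hηc, hηe⟩ : ∃ η, 0 < η ∧ η ≤ δ ∧ η ≤ x - a ∧ η ≤ b - x ∧
      η ≤ y - c ∧ η ≤ e - y := by
    refine ⟨min δ (min (min (x - a) (b - x)) (min (y - c) (e - y))), ?_, ?_⟩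
    · simpa only [lt_min_iff, sub_pos] using ⟨pos, ⟨hax, hxb⟩, hcy, hye⟩
    · simp only [min_le_iff, le_refl, true_or, or_true, and_self]
  have mono : rectangleCount F d V (x - η) (x + η) (y - η) (y + η) ≤
      rectangleCount F d V a b c e :=
    rectangleCount_mono F d (by linarith) (by linarith) (by linarith) hbc.le (by linarith)
      (by linarith) (by linarith)
  rw [rectangleCount_small_eq F d hT hδ hx hy hxy h0 hηδ, hk, ← hm] at mono
  exact_mod_cast mono

theorem multiplicity_eq_zero {x y : ℝ} (hxy : x < y)
    (h : x ∉ distances V ∨ y ∉ distances V) : multiplicity F d V (x, y) = 0 := by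
  classical
  obtain ⟨δ, hδ⟩ := exists_isGap (insert x (insert y (distances V)))
  have hx : x ∈ insert x (insert y (distances V)) := by simp
  have hy : y ∈ insert x (insert y (distances V)) := by simp
  have pos := hδ.pos
  have gap := hδ.add_lt x hx y hy hxy
  have eq_of_notMem : ∀ z ∈ insert x (insert y (distances V)), z ∉ distances V →
      ripsComplex V z = ripsComplex V (z + δ) := by
    intro z hz hzV
    refine ripsComplex_eq_of_disjoint subset_rfl (by linarith) fun u hu h => ?_
    have hlt := lt_of_le_of_ne h.1 fun e => hzV (e ▸ hu)
    linarith [hδ.add_lt z hz u (by simp [hu]) hlt, h.2]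
  suffices hzero : rectangleCount F d V x (x + δ) y (y + δ) = 0 by
    rw [← multiplicity_eq F d (fun u hu => by simp [hu]) hδ hx hy hxy] at hzero
    exact_mod_cast hzero
  rcases h with h | h
  · rw [← rectangleCount_self_left F d (V := V) x y (y + δ)]
    exact rectangleCount_congr F d (by linarith) (by linarith) (by linarith) le_rfl (by linarith)
      (by linarith) rfl (eq_of_notMem x hx h).symm rfl rfl
  · rw [← rectangleCount_self_right F d (V := V) x (x + δ) y]
    exact rectangleCount_congr F d (by linarith) (by linarith) (by linarith) (by linarith)
      (by linarith) le_rfl rfl rfl rfl (eq_of_notMem y hy h).symm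

theorem multiplicity_le {x y : ℝ} (hxy : x < y) :
    multiplicity F d V (x, y) ≤ 2 * Nat.card V ^ (d + 1) := by
  classical
  obtain ⟨δ, hδ⟩ := exists_isGap (insert x (insert y (distances V)))
  have count_le := rectangleCount_le F d (V := V) x (x + δ) y (y + δ)
  rw [← multiplicity_eq F d (fun u hu => by simp [hu]) hδ (by simp) (by simp) hxy] at count_le
  exact_mod_cast count_le

theorem sum_rectangleCount_left (hT : distances V ⊆ T) (hδ : IsGap T δ) {a b c e : ℝ}
    (hb : b ∈ T) (hab : a ≤ b) (hbc : b ≤ c) (hce : c ≤ e) :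
    ∑ x ∈ T with x ∈ Set.Ico a b, rectangleCount F d V x (x + δ) c e =
      rectangleCount F d V a b c e := by
  have jumps := sum_jumps (S := {x ∈ T | x ∈ Set.Ico a b})
    (g := fun s => rectangleCount F d V a s c e) hδ.pos hab ?_ ?_ ?_
  · simpa only [rectangleCount_sub_left, rectangleCount_self_left, sub_zero] using jumps
  · intro x hx
    rw [Finset.mem_filter, Set.mem_Ico] at hx
    exact ⟨hx.2.1, by linarith [hδ.add_lt x hx.1 b hb hx.2.2, hδ.pos]⟩
  · intro x hx y hy hxy
    linarith [hδ.add_lt x (Finset.mem_filter.1 hx).1 y (Finset.mem_filter.1 hy).1 hxy, hδ.pos]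
  · intro s t has hst htb h
    refine rectangleCount_congr F d has (hst.trans (htb.trans hbc)) hce (has.trans hst)
      (htb.trans hbc) hce rfl (ripsComplex_eq_of_disjoint hT hst fun x hx hxst => ?_) rfl rfl
    exact h x (Finset.mem_filter.2 ⟨hx, has.trans hxst.1, hxst.2.trans_le htb⟩) hxst

theorem sum_rectangleCount_right (hT : distances V ⊆ T) (hδ : IsGap T δ) {a b c e : ℝ}
    (he : e ∈ T) (hab : a ≤ b) (hbc : b ≤ c) (hce : c ≤ e) :
    ∑ y ∈ T with y ∈ Set.Ico c e, rectangleCount F d V a b y (y + δ) =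
      rectangleCount F d V a b c e := by
  have jumps := sum_jumps (S := {y ∈ T | y ∈ Set.Ico c e})
    (g := fun t => rectangleCount F d V a b c t) hδ.pos hce ?_ ?_ ?_
  · simpa only [rectangleCount_sub_right, rectangleCount_self_right, sub_zero] using jumps
  · intro y hy
    rw [Finset.mem_filter, Set.mem_Ico] at hy
    exact ⟨hy.2.1, by linarith [hδ.add_lt y hy.1 e he hy.2.2, hδ.pos]⟩
  · intro x hx y hy hxy
    linarith [hδ.add_lt x (Finset.mem_filter.1 hx).1 y (Finset.mem_filter.1 hy).1 hxy, hδ.pos]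
  · intro s t hcs hst hte h
    refine rectangleCount_congr F d hab hbc hcs hab hbc (hcs.trans hst) rfl rfl rfl
      (ripsComplex_eq_of_disjoint hT hst fun y hy hyst => ?_)
    exact h y (Finset.mem_filter.2 ⟨hy, hcs.trans hyst.1, hyst.2.trans_le hte⟩) hyst

theorem sum_multiplicity_eq_rectangleCount (hT : distances V ⊆ T) {a b c e : ℝ} (hb : b ∈ T)
    (he : e ∈ T) (hab : a ≤ b) (hbc : b ≤ c) (hce : c ≤ e) :
    ∑ x ∈ T with x ∈ Set.Ico a b, ∑ y ∈ T with y ∈ Set.Ico c e, (multiplicity F d V (x, y) : ℤ) =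
      rectangleCount F d V a b c e := by
  obtain ⟨δ, hδ⟩ := exists_isGap T
  rw [← sum_rectangleCount_left F d hT hδ hb hab hbc hce]
  refine Finset.sum_congr rfl fun x hx => ?_
  simp only [Finset.mem_filter, Set.mem_Ico] at hx
  have gap := hδ.add_lt x hx.1 b hb hx.2.2
  have pos := hδ.pos
  rw [← sum_rectangleCount_right F d hT hδ he (by linarith) (by linarith) hce]
  refine Finset.sum_congr rfl fun y hy => ?_
  simp only [Finset.mem_filter, Set.mem_Ico] at hy
  exact multiplicity_eq F d hT hδ hx.1 hy.1 (by linarith)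

end Multiplicity

/-! ### The diagram as a finite sum -/

section Diagram

variable (F : Type*) [Field F] (d : ℕ) {E : Type*} [MetricSpace E] {S : Set E} [Finite S]
  {T : Finset ℝ}

theorem diagram_eq_sum (hT : distances S ⊆ T) :
    diagram F d S = ∑ z ∈ T ×ˢ T with z.1 < z.2,
      (multiplicity F d S z : ℝ≥0∞) • Measure.dirac z := by
  classical
  ext A hA
  rw [diagram, Measure.sum_apply _ hA, tsum_eq_sum (s := (T ×ˢ T).subtype (· ∈ halfPlane))]
  · rw [Finset.sum_subtype_eq_sum_filter (s := T ×ˢ T) (p := (· ∈ halfPlane))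
      (f := fun z => ((multiplicity F d S z : ℝ≥0∞) • Measure.dirac z) A), Measure.finsetSum_apply]
    rfl
  · rintro ⟨⟨x, y⟩, hxy⟩ hz
    have notMem : x ∉ distances S ∨ y ∉ distances S := by
      rw [Finset.mem_subtype, Finset.mem_product, not_and_or] at hz
      exact hz.imp (mt fun h => hT h) (mt fun h => hT h)
    simp [multiplicity_eq_zero F d hxy notMem]

theorem diagram_Ico_prod_Ico {a b c e : ℝ} (hab : a ≤ b) (hbc : b ≤ c) (hce : c ≤ e) :
    diagram F d S (Set.Ico a b ×ˢ Set.Ico c e) =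
      ((rectangleCount F d S a b c e).toNat : ℝ≥0∞) := by
  classical
  have hT : distances S ⊆ insert b (insert e (distances S)) := fun x hx => by simp [hx]
  generalize hT_eq : insert b (insert e (distances S)) = T at hT
  have filter_eq : {z ∈ {z ∈ T ×ˢ T | z.1 < z.2} | z ∈ Set.Ico a b ×ˢ Set.Ico c e} =
      {x ∈ T | x ∈ Set.Ico a b} ×ˢ {y ∈ T | y ∈ Set.Ico c e} := by
    ext ⟨x, y⟩
    simp only [Finset.mem_filter, Finset.mem_product, Set.mem_prod, Set.mem_Ico]
    grind
  rw [← sum_multiplicity_eq_rectangleCount F d hT (by simp [← hT_eq]) (by simp [← hT_eq])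
    hab hbc hce, ← Finset.sum_product', ← filter_eq, ← Nat.cast_sum, Int.toNat_natCast,
    diagram_eq_sum F d hT, Measure.finsetSum_apply, Nat.cast_sum,
    Finset.sum_filter (s := Finset.filter _ _)]
  refine Finset.sum_congr rfl fun z _ => ?_
  simp [Set.indicator_apply, measurableSet_Ico.prod measurableSet_Ico]

theorem diagram_univ_le : diagram F d S Set.univ ≤ 2 * Nat.card S ^ (d + 5) := by
  rw [diagram_eq_sum F d subset_rfl, Measure.finsetSum_apply]
  simp only [Measure.smul_apply, smul_eq_mul, measure_univ, mul_one]
  norm_cast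
  calc ∑ z ∈ distances S ×ˢ distances S with z.1 < z.2, multiplicity F d S z
      ≤ {z ∈ distances S ×ˢ distances S | z.1 < z.2}.card • (2 * Nat.card S ^ (d + 1)) :=
        Finset.sum_le_card_nsmul _ _ _ fun z hz => multiplicity_le F d (Finset.mem_filter.1 hz).2
    _ ≤ (Nat.card S ^ 2 * Nat.card S ^ 2) * (2 * Nat.card S ^ (d + 1)) := by
        rw [smul_eq_mul]
        gcongr
        exact (Finset.card_filter_le _ _).trans (Finset.card_product _ _ ▸
          Nat.mul_le_mul card_distances_le card_distances_le)
    _ = 2 * Nat.card S ^ (d + 5) := by ring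

instance : IsFiniteMeasure (diagram F d S) :=
  ⟨(diagram_univ_le F d).trans_lt (by finiteness)⟩

theorem ae_mem_distances_diagram :
    ∀ᵐ z ∂diagram F d S, z.1 ∈ distances S ∧ z.2 ∈ distances S ∧ z.1 < z.2 := by
  rw [diagram_eq_sum F d subset_rfl, ae_finsetSum_measure_iff]
  intro z hz
  rw [Finset.mem_filter, Finset.mem_product, and_assoc] at hz
  exact Measure.ae_smul_measure (by rw [ae_dirac_eq]; exact hz) _

end Diagram

/-! ### Optimal partial transport -/

section Transport

variable {p : ℝ} {μ ν μ₁ ν₁ μ₂ ν₂ : Measure (ℝ × ℝ)}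

theorem measurable_cost :
    Measurable fun w : (ℝ × ℝ) × (ℝ × ℝ) => ENNReal.ofReal (cost p w.1 w.2) := by
  unfold cost
  fun_prop

theorem measurableSet_closedHalfPlane : MeasurableSet closedHalfPlane :=
  measurableSet_le measurable_fst measurable_snd

theorem cost_comm (x y : ℝ × ℝ) : cost p x y = cost p y x := by
  simp only [cost, abs_sub_comm]

theorem cost_le_of_abs_sub_le (hp : 0 ≤ p) {x y : ℝ × ℝ} {L : ℝ} (h₁ : |x.1 - y.1| ≤ L)
    (h₂ : |x.2 - y.2| ≤ L) : cost p x y ≤ 2 * L ^ p := by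
  unfold cost
  linarith [Real.rpow_le_rpow (abs_nonneg _) h₁ hp, Real.rpow_le_rpow (abs_nonneg _) h₂ hp]

theorem OT_rpow_eq_iInf (hp : 0 < p) (μ ν : Measure (ℝ × ℝ)) :
    OT p μ ν ^ p = ⨅ (γ : Measure ((ℝ × ℝ) × (ℝ × ℝ))) (_ : IsPartialPlan μ ν γ),
      ∫⁻ w, ENNReal.ofReal (cost p w.1 w.2) ∂γ := by
  simp only [OT, ← ENNReal.orderIsoRpow_apply p hp, OrderIso.map_iInf]
  simp only [ENNReal.orderIsoRpow_apply, one_div, ENNReal.rpow_inv_rpow hp.ne']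

theorem OT_rpow_le (hp : 0 < p) {γ : Measure ((ℝ × ℝ) × (ℝ × ℝ))} (h : IsPartialPlan μ ν γ) :
    OT p μ ν ^ p ≤ ∫⁻ w, ENNReal.ofReal (cost p w.1 w.2) ∂γ :=
  (OT_rpow_eq_iInf hp μ ν).trans_le (iInf₂_le γ h)

theorem IsPartialPlan.add {γ₁ γ₂ : Measure ((ℝ × ℝ) × (ℝ × ℝ))} (h₁ : IsPartialPlan μ₁ ν₁ γ₁)
    (h₂ : IsPartialPlan μ₂ ν₂ γ₂) : IsPartialPlan (μ₁ + μ₂) (ν₁ + ν₂) (γ₁ + γ₂) where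
  locallyFinite := by
    refine ⟨fun x => ?_⟩
    have := h₁.locallyFinite
    have := h₂.locallyFinite
    obtain ⟨U₁, hU₁, h₁⟩ := γ₁.finiteAt_nhds x
    obtain ⟨U₂, hU₂, h₂⟩ := γ₂.finiteAt_nhds x
    exact ⟨U₁ ∩ U₂, Filter.inter_mem hU₁ hU₂, ENNReal.add_lt_top.2
      ⟨(measure_mono Set.inter_subset_left).trans_lt h₁,
        (measure_mono Set.inter_subset_right).trans_lt h₂⟩⟩
  carried := by simp [h₁.carried, h₂.carried]
  left P hP hm := by simp [h₁.left P hP hm, h₂.left P hP hm]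
  right Q hQ hm := by simp [h₁.right Q hQ hm, h₂.right Q hQ hm]

theorem IsPartialPlan.smul {γ : Measure ((ℝ × ℝ) × (ℝ × ℝ))} (h : IsPartialPlan μ ν γ)
    (c : NNReal) : IsPartialPlan (c • μ) (c • ν) (c • γ) where
  locallyFinite := by
    have := h.locallyFinite
    infer_instance
  carried := by simp [h.carried]
  left P hP hm := by simp [h.left P hP hm]
  right Q hQ hm := by simp [h.right Q hQ hm]

theorem IsPartialPlan.swap {γ : Measure ((ℝ × ℝ) × (ℝ × ℝ))} (h : IsPartialPlan μ ν γ) :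
    IsPartialPlan ν μ (γ.map Prod.swap) := by
  have map_swap_prod : ∀ P Q, MeasurableSet P → MeasurableSet Q →
      γ.map Prod.swap (P ×ˢ Q) = γ (Q ×ˢ P) := fun P Q hP hQ => by
    rw [Measure.map_apply measurable_swap (hP.prod hQ), Set.preimage_swap_prod]
  have hC := measurableSet_closedHalfPlane
  constructor
  · refine ⟨fun x => ?_⟩
    have := h.locallyFinite
    obtain ⟨U, hU, finite⟩ := γ.finiteAt_nhds x.swap
    refine ⟨Prod.swap ⁻¹' U, continuous_swap.continuousAt hU, ?_⟩
    have map_apply : γ.map Prod.swap (Prod.swap ⁻¹' U) = γ U :=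
      MeasurableEquiv.prodComm.map_apply _
    rwa [map_apply]
  · rw [Measure.map_apply measurable_swap (hC.prod hC).compl, Set.preimage_compl,
      Set.preimage_swap_prod, h.carried]
  · exact fun P hP hm => (map_swap_prod _ _ hm hC).trans (h.right P hP hm)
  · exact fun Q hQ hm => (map_swap_prod _ _ hC hm).trans (h.left Q hQ hm)

theorem OT_comm (μ ν : Measure (ℝ × ℝ)) : OT p μ ν = OT p ν μ := by
  suffices h : ∀ μ ν : Measure (ℝ × ℝ), OT p μ ν ≤ OT p ν μ from le_antisymm (h μ ν) (h ν μ)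
  refine fun μ ν => le_iInf₂ fun γ hγ => (iInf₂_le _ hγ.swap).trans_eq ?_
  rw [lintegral_map measurable_cost measurable_swap]
  simp only [Prod.fst_swap, Prod.snd_swap, cost_comm]

theorem isPartialPlan_zero : IsPartialPlan 0 0 0 where
  locallyFinite := inferInstance
  carried := rfl
  left _ _ _ := rfl
  right _ _ _ := rfl

theorem OT_zero_rpow (hp : 0 < p) : OT p 0 0 ^ p = 0 :=
  nonpos_iff_eq_zero.1 ((OT_rpow_le hp isPartialPlan_zero).trans_eq (lintegral_zero_measure _))

theorem OT_add_rpow_le (hp : 0 < p) :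
    OT p (μ₁ + μ₂) (ν₁ + ν₂) ^ p ≤ OT p μ₁ ν₁ ^ p + OT p μ₂ ν₂ ^ p := by
  rw [OT_rpow_eq_iInf hp μ₁, OT_rpow_eq_iInf hp μ₂]
  exact ENNReal.le_iInf₂_add_iInf₂ fun γ₁ h₁ γ₂ h₂ =>
    (OT_rpow_le hp (h₁.add h₂)).trans_eq (lintegral_add_measure _ _ _)

theorem OT_sum_rpow_le (hp : 0 < p) {ι : Type*} (s : Finset ι) (μ ν : ι → Measure (ℝ × ℝ)) :
    OT p (∑ i ∈ s, μ i) (∑ i ∈ s, ν i) ^ p ≤ ∑ i ∈ s, OT p (μ i) (ν i) ^ p := by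
  classical
  induction s using Finset.induction_on with
  | empty => simp [OT_zero_rpow hp]
  | insert i s hi ih =>
    simp only [Finset.sum_insert hi]
    exact (OT_add_rpow_le hp).trans (by gcongr)

theorem OT_smul_rpow_le (hp : 0 < p) (c : NNReal) :
    OT p (c • μ) (c • ν) ^ p ≤ c * OT p μ ν ^ p := by
  rcases eq_or_ne c 0 with rfl | hc
  · simp [OT_zero_rpow hp]
  rw [OT_rpow_eq_iInf hp μ, ENNReal.mul_iInf_of_ne (by simpa) ENNReal.coe_ne_top]
  refine le_iInf fun γ => ?_
  rw [ENNReal.mul_iInf_of_ne (by simpa) ENNReal.coe_ne_top]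
  exact le_iInf fun h => (OT_rpow_le hp (h.smul c)).trans_eq (lintegral_smul_measure _ _)

theorem OT_average_rpow_le (hp : 0 < p) {B : ℕ} (hB : B ≠ 0) (μ : Fin B → Measure (ℝ × ℝ)) (ν) :
    OT p ((B : ℝ≥0∞)⁻¹ • ∑ i, μ i) ν ^ p ≤ (B : ℝ≥0∞)⁻¹ * ∑ i, OT p (μ i) ν ^ p := by
  have average_const : (B : NNReal)⁻¹ • ∑ _i : Fin B, ν = ν := by
    rw [Finset.sum_const, Finset.card_univ, Fintype.card_fin, ← Nat.cast_smul_eq_nsmul NNReal,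
      inv_smul_smul₀ (by exact_mod_cast hB)]
  have coe_inv : (((B : NNReal)⁻¹ : NNReal) : ℝ≥0∞) = (B : ℝ≥0∞)⁻¹ := by
    rw [ENNReal.coe_inv (by exact_mod_cast hB), ENNReal.coe_natCast]
  calc OT p ((B : ℝ≥0∞)⁻¹ • ∑ i, μ i) ν ^ p
      = OT p ((B : NNReal)⁻¹ • ∑ i, μ i) ((B : NNReal)⁻¹ • ∑ _i : Fin B, ν) ^ p := by
        rw [average_const, ← coe_inv, ENNReal.smul_def]
    _ ≤ (B : ℝ≥0∞)⁻¹ * OT p (∑ i, μ i) (∑ _i : Fin B, ν) ^ p :=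
        coe_inv ▸ OT_smul_rpow_le hp _
    _ ≤ (B : ℝ≥0∞)⁻¹ * ∑ i, OT p (μ i) ν ^ p := by
        gcongr
        exact OT_sum_rpow_le hp _ _ _

theorem isPartialPlan_prod [IsFiniteMeasure μ] [IsFiniteMeasure ν]
    (hmass : μ Set.univ = ν Set.univ) (hν₀ : ν ≠ 0) (hμ : ∀ᵐ z ∂μ, z ∈ closedHalfPlane)
    (hν : ∀ᵐ z ∂ν, z ∈ closedHalfPlane) : IsPartialPlan μ ν ((ν Set.univ)⁻¹ • μ.prod ν) := by
  have ne_zero : ν Set.univ ≠ 0 := Measure.measure_univ_ne_zero.2 hν₀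
  have ne_top : ν Set.univ ≠ ⊤ := measure_ne_top _ _
  have measure_closedHalfPlane {ρ : Measure (ℝ × ℝ)} (hρ : ∀ᵐ z ∂ρ, z ∈ closedHalfPlane) :
      ρ closedHalfPlane = ρ Set.univ := measure_eq_measure_of_null_sdiff
    (Set.subset_univ _) (by rwa [← Set.compl_eq_univ_sdiff])
  constructor
  · have := Measure.smul_finite (μ.prod ν) (ENNReal.inv_ne_top.2 ne_zero)
    infer_instance
  · rw [Measure.smul_apply, smul_eq_mul]
    refine mul_eq_zero_of_right _ ?_
    have hC := measurableSet_closedHalfPlane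
    refine (Measure.ae_prod_mem_iff_ae_ae_mem (hC.prod hC)).2 ?_
    filter_upwards [hμ] with z hz
    filter_upwards [hν] with w hw using ⟨hz, hw⟩
  · intro P _ _
    rw [Measure.smul_apply, Measure.prod_prod, measure_closedHalfPlane hν, smul_eq_mul,
      mul_comm (μ P), ENNReal.inv_mul_cancel_left ne_zero ne_top]
  · intro Q _ _
    rw [Measure.smul_apply, Measure.prod_prod, measure_closedHalfPlane hμ, hmass, smul_eq_mul,
      ENNReal.inv_mul_cancel_left ne_zero ne_top]

theorem OT_rpow_le_of_measure_univ_eq (hp : 0 < p) [IsFiniteMeasure μ] [IsFiniteMeasure ν]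
    (hmass : μ Set.univ = ν Set.univ) {A : Set (ℝ × ℝ)} (hA : A ⊆ closedHalfPlane)
    (hμ : ∀ᵐ z ∂μ, z ∈ A) (hν : ∀ᵐ z ∂ν, z ∈ A) {c : ℝ}
    (hc : ∀ z ∈ A, ∀ w ∈ A, cost p z w ≤ c) :
    OT p μ ν ^ p ≤ ENNReal.ofReal c * μ Set.univ := by
  rcases eq_or_ne ν 0 with rfl | hν₀
  · obtain rfl : μ = 0 := Measure.measure_univ_eq_zero.1 hmass
    exact (OT_zero_rpow hp).trans_le zero_le
  have mass_prod : μ.prod ν Set.univ = ν Set.univ * μ Set.univ := by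
    rw [← Set.univ_prod_univ, Measure.prod_prod, mul_comm]
  have cost_le : ∀ᵐ w ∂μ.prod ν, ENNReal.ofReal (cost p w.1 w.2) ≤ ENNReal.ofReal c := by
    refine (Measure.ae_prod_iff_ae_ae (measurableSet_le measurable_cost measurable_const)).2 ?_
    filter_upwards [hμ] with z hz
    filter_upwards [hν] with w hw using ENNReal.ofReal_le_ofReal (hc z hz w hw)
  calc OT p μ ν ^ p
      ≤ (ν Set.univ)⁻¹ * ∫⁻ w, ENNReal.ofReal (cost p w.1 w.2) ∂μ.prod ν :=
        (OT_rpow_le hp (isPartialPlan_prod hmass hν₀ (hμ.mono hA) (hν.mono hA))).trans_eq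
          (lintegral_smul_measure _ _)
    _ ≤ (ν Set.univ)⁻¹ * ∫⁻ _, ENNReal.ofReal c ∂μ.prod ν :=
        mul_le_mul_right (lintegral_mono_ae cost_le) _
    _ = ENNReal.ofReal c * ((ν Set.univ)⁻¹ * (ν Set.univ * μ Set.univ)) := by
        rw [lintegral_const, mass_prod]
        ring
    _ = ENNReal.ofReal c * μ Set.univ := by
        rw [ENNReal.inv_mul_cancel_left (Measure.measure_univ_ne_zero.2 hν₀) (measure_ne_top _ _)]

theorem isPartialPlan_diagonal [IsFiniteMeasure μ] (hμ : ∀ᵐ z ∂μ, z ∈ closedHalfPlane) :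
    IsPartialPlan μ 0 (μ.map fun z => (z, (z.1, z.1))) := by
  have measurable : Measurable fun z : ℝ × ℝ => (z, ((z.1, z.1) : ℝ × ℝ)) := by fun_prop
  have hC := measurableSet_closedHalfPlane
  refine ⟨inferInstance, ?_, fun P _ hm => ?_, fun Q hQ hm => ?_⟩
  · rw [Measure.map_apply measurable (hC.prod hC).compl]
    filter_upwards [hμ] with z hz using ⟨hz, le_refl z.1⟩
  · rw [Measure.map_apply measurable (hm.prod hC)]
    congr 1
    ext z
    simp [closedHalfPlane]
  · rw [Measure.map_apply measurable (hC.prod hm), Measure.coe_zero, Pi.zero_apply]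
    convert measure_empty (μ := μ)
    ext z
    simpa using fun _ h => lt_irrefl z.1 (hQ h)

theorem OT_zero_rpow_le (hp : 0 < p) [IsFiniteMeasure μ] {L : ℝ}
    (hμ : ∀ᵐ z ∂μ, z.1 ≤ z.2 ∧ |z.1 - z.2| ≤ L) :
    OT p μ 0 ^ p ≤ ENNReal.ofReal (2 * L ^ p) * μ Set.univ := by
  refine (OT_rpow_le hp (isPartialPlan_diagonal (hμ.mono fun z hz => hz.1))).trans ?_
  rw [lintegral_map measurable_cost (by fun_prop), ← lintegral_const]
  refine lintegral_mono_ae ?_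
  filter_upwards [hμ] with z hz
  refine ENNReal.ofReal_le_ofReal (cost_le_of_abs_sub_le hp.le ?_ (abs_sub_comm z.1 z.2 ▸ hz.2))
  simpa using (abs_nonneg _).trans hz.2

variable {ι : Type*} [LinearOrder ι] {κ : ℝ → ι}

theorem measurableSet_box (hκ : Monotone κ) (q : ι × ι) :
    MeasurableSet (Prod.map κ κ ⁻¹' {q}) := by
  rw [← Prod.mk.eta (p := q), ← Set.singleton_prod_singleton, Set.preimage_prod_map_prod]
  exact (Set.ordConnected_singleton.preimage_mono hκ).measurableSet.prod
    (Set.ordConnected_singleton.preimage_mono hκ).measurableSet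

theorem sum_restrict_box [Fintype ι] (hκ : Monotone κ) (μ : Measure (ℝ × ℝ)) :
    ∑ q : ι × ι, μ.restrict (Prod.map κ κ ⁻¹' {q}) = μ := by
  rw [← Measure.sum_fintype, ← Measure.restrict_iUnion _ (measurableSet_box hκ),
    ← Set.preimage_iUnion, Set.iUnion_of_singleton, Set.preimage_univ, Measure.restrict_univ]
  exact fun q q' h => (Set.disjoint_singleton.2 h).preimage _

theorem OT_restrict_box_rpow_le (hp : 0 < p) [IsFiniteMeasure μ] [IsFiniteMeasure ν]
    (hκ : Monotone κ) {T : Finset ℝ} {L : ℝ}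
    (hL : ∀ x ∈ T, ∀ y ∈ T, κ x = κ y → |x - y| ≤ L)
    (hμ : ∀ᵐ z ∂μ, z.1 ∈ T ∧ z.2 ∈ T ∧ z.1 < z.2) (hν : ∀ᵐ z ∂ν, z.1 ∈ T ∧ z.2 ∈ T ∧ z.1 < z.2)
    (hbox : ∀ i j, i < j → μ (Prod.map κ κ ⁻¹' {(i, j)}) = ν (Prod.map κ κ ⁻¹' {(i, j)}))
    (q : ι × ι) :
    OT p (μ.restrict (Prod.map κ κ ⁻¹' {q})) (ν.restrict (Prod.map κ κ ⁻¹' {q})) ^ p ≤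
      ENNReal.ofReal (2 * L ^ p) *
        (μ.restrict (Prod.map κ κ ⁻¹' {q}) Set.univ +
          ν.restrict (Prod.map κ κ ⁻¹' {q}) Set.univ) := by
  have ae_mem {ρ : Measure (ℝ × ℝ)} (hρ : ∀ᵐ z ∂ρ, z.1 ∈ T ∧ z.2 ∈ T ∧ z.1 < z.2) :
      ∀ᵐ z ∂ρ.restrict (Prod.map κ κ ⁻¹' {q}),
        (z.1 ∈ T ∧ z.2 ∈ T ∧ z.1 < z.2) ∧ κ z.1 = q.1 ∧ κ z.2 = q.2 := by
    filter_upwards [ae_restrict_of_ae hρ, ae_restrict_mem (measurableSet_box hκ q)] with z hz hzq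
    exact ⟨hz, congrArg Prod.fst hzq, congrArg Prod.snd hzq⟩
  rcases lt_trichotomy q.1 q.2 with hlt | heq | hgt
  · have mass_eq := hbox _ _ hlt
    rw [← Measure.restrict_apply_univ, ← Measure.restrict_apply_univ (μ := ν)] at mass_eq
    refine (OT_rpow_le_of_measure_univ_eq hp mass_eq (fun z hz => hz.1.2.2.le) (ae_mem hμ)
      (ae_mem hν) fun z hz w hw => ?_).trans (by gcongr; exact le_self_add)
    exact cost_le_of_abs_sub_le hp.le (hL _ hz.1.1 _ hw.1.1 (hz.2.1.trans hw.2.1.symm))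
      (hL _ hz.1.2.1 _ hw.1.2.1 (hz.2.2.trans hw.2.2.symm))
  · have OT_diagonal_le {ρ : Measure (ℝ × ℝ)} [IsFiniteMeasure ρ]
        (hρ : ∀ᵐ z ∂ρ, z.1 ∈ T ∧ z.2 ∈ T ∧ z.1 < z.2) :=
      OT_zero_rpow_le hp (L := L) ((ae_mem hρ).mono fun z hz =>
        ⟨hz.1.2.2.le, hL _ hz.1.1 _ hz.1.2.1 (by rw [hz.2.1, hz.2.2, heq])⟩)
    have split := OT_add_rpow_le hp (μ₁ := μ.restrict (Prod.map κ κ ⁻¹' {q})) (ν₁ := 0) (μ₂ := 0)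
      (ν₂ := ν.restrict (Prod.map κ κ ⁻¹' {q}))
    rw [add_zero, zero_add, OT_comm 0] at split
    exact split.trans ((add_le_add (OT_diagonal_le hμ) (OT_diagonal_le hν)).trans_eq
      (mul_add _ _ _).symm)
  · have restrict_eq_zero {ρ : Measure (ℝ × ℝ)} (hρ : ∀ᵐ z ∂ρ, z.1 ∈ T ∧ z.2 ∈ T ∧ z.1 < z.2) :
        ρ.restrict (Prod.map κ κ ⁻¹' {q}) = 0 := by
      refine ae_eq_bot.1 (Filter.eventually_false_iff_eq_bot.1 ((ae_mem hρ).mono fun z hz => ?_))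
      exact (hκ hz.1.2.2.le).not_gt (hz.2.1 ▸ hz.2.2 ▸ hgt)
    rw [restrict_eq_zero hμ, restrict_eq_zero hν, OT_zero_rpow hp]
    exact zero_le

theorem OT_rpow_le_of_measure_box_eq [Finite ι] (hp : 0 < p) [IsFiniteMeasure μ]
    [IsFiniteMeasure ν] (hκ : Monotone κ) {T : Finset ℝ} {L : ℝ}
    (hL : ∀ x ∈ T, ∀ y ∈ T, κ x = κ y → |x - y| ≤ L)
    (hμ : ∀ᵐ z ∂μ, z.1 ∈ T ∧ z.2 ∈ T ∧ z.1 < z.2) (hν : ∀ᵐ z ∂ν, z.1 ∈ T ∧ z.2 ∈ T ∧ z.1 < z.2)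
    (hbox : ∀ i j, i < j → μ (Prod.map κ κ ⁻¹' {(i, j)}) = ν (Prod.map κ κ ⁻¹' {(i, j)})) :
    OT p μ ν ^ p ≤ ENNReal.ofReal (2 * L ^ p) * (μ Set.univ + ν Set.univ) := by
  have := Fintype.ofFinite ι
  have le_sum := (OT_sum_rpow_le hp Finset.univ _ _).trans
    (Finset.sum_le_sum fun q _ => OT_restrict_box_rpow_le hp hκ hL hμ hν hbox q)
  rwa [sum_restrict_box hκ, sum_restrict_box hκ, ← Finset.mul_sum, Finset.sum_add_distrib,
    ← Measure.finsetSum_apply, ← Measure.finsetSum_apply, sum_restrict_box hκ,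
    sum_restrict_box hκ] at le_sum

end Transport

/-! ### Cutting the scales at the gaps -/

section Cuts

theorem sub_le_mul_card {T : Finset ℝ} {η x y : ℝ} (hη : 0 ≤ η) (hx : x ∈ T) (hxy : x ≤ y)
    (h : ∀ u ∈ T, x ≤ u → u < y → ∃ v ∈ T, u < v ∧ v < u + η) :
    y - x ≤ η * {u ∈ T | x ≤ u ∧ u < y}.card := by
  induction hn : {u ∈ T | x ≤ u ∧ u < y}.card using Nat.strong_induction_on generalizing x with
  | _ n ih =>
  subst hn
  rcases hxy.eq_or_lt with rfl | hlt
  · rw [sub_self]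
    positivity
  obtain ⟨v, hv, hxv, hvx⟩ := h x hx le_rfl hlt
  have card_lt : {u ∈ T | v ≤ u ∧ u < y}.card < {u ∈ T | x ≤ u ∧ u < y}.card := by
    refine Finset.card_lt_card ((Finset.ssubset_iff_of_subset fun u hu => ?_).2
      ⟨x, by simp [hx, hlt], by simp [hxv]⟩)
    rw [Finset.mem_filter] at hu ⊢
    exact ⟨hu.1, hxv.le.trans hu.2.1, hu.2.2⟩
  have card_add_one_le : η * {u ∈ T | v ≤ u ∧ u < y}.card + η ≤
      η * {u ∈ T | x ≤ u ∧ u < y}.card := by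
    rw [← mul_add_one]
    exact mul_le_mul_of_nonneg_left (by exact_mod_cast card_lt) hη
  rcases le_total v y with hvy | hyv
  · linarith [ih _ card_lt hv hvy (fun u hu hvu => h u hu (hxv.le.trans hvu)) rfl]
  · linarith [show 0 ≤ η * {u ∈ T | v ≤ u ∧ u < y}.card by positivity]

/-- The number of elements of `G` that are at most `z`, which labels the intervals into which `G`
cuts the line. -/
def cutIndex (G : Finset ℝ) (z : ℝ) : Fin (G.card + 1) :=
  ⟨{g ∈ G | g ≤ z}.card, Nat.lt_succ_of_le (Finset.card_filter_le _ _)⟩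

variable {G T : Finset ℝ} {ε x y z : ℝ}

theorem cutIndex_mono (G : Finset ℝ) : Monotone (cutIndex G) := fun _ _ h =>
  Finset.card_le_card (Finset.monotone_filter_right _ fun _ _ hg => hg.trans h)

theorem cutIndex_lt {g : ℝ} (hg : g ∈ G) (hx : x < g) (hy : g ≤ y) :
    cutIndex G x < cutIndex G y := by
  refine Finset.card_lt_card ((Finset.ssubset_iff_of_subset ?_).2
    ⟨g, by simp [hg, hy], by simp [hx]⟩)
  exact Finset.monotone_filter_right _ fun _ _ hu => hu.trans (hx.le.trans hy)

theorem exists_preimage_cutIndex_eq_Ico (hlow : ∃ g ∈ G, g ≤ z) (hhigh : ∃ g ∈ G, z < g) :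
    ∃ a ∈ G, ∃ b ∈ G, z ∈ Set.Ico a b ∧ cutIndex G ⁻¹' {cutIndex G z} = Set.Ico a b := by
  obtain ⟨a, ha, a_max⟩ := {g ∈ G | g ≤ z}.exists_max_image id
    (hlow.imp fun _ => Finset.mem_filter.2)
  obtain ⟨b, hb, b_min⟩ := {g ∈ G | z < g}.exists_min_image id
    (hhigh.imp fun _ => Finset.mem_filter.2)
  simp only [Finset.mem_filter, id] at ha a_max hb b_min
  refine ⟨a, ha.1, b, hb.1, ⟨ha.2, hb.2⟩, Set.ext fun w => ⟨fun h => ⟨?_, ?_⟩, fun h => ?_⟩⟩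
  · by_contra! hw
    exact (cutIndex_lt ha.1 hw ha.2).ne h
  · by_contra! hw
    exact (cutIndex_lt hb.1 hb.2 hw).ne' h
  · refine Fin.ext (congrArg Finset.card (Finset.filter_congr fun g hg => ⟨fun hgw => ?_,
      fun hgz => (a_max g ⟨hg, hgz⟩).trans h.1⟩))
    by_contra! hgz
    linarith [b_min g ⟨hg, hgz⟩, h.2]

/-- Cut points of `T ⊆ [0, ∞)` at scale `ε`: one in each gap of length at least `3 * ε` above a
point of `T`, and one below `T`. No point of `T` lies within `2 * ε` above a cut point. -/
def cuts (T : Finset ℝ) (ε : ℝ) : Finset ℝ :=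
  insert (-2 * ε) ({x ∈ T | ∀ u ∈ T, x < u → x + 3 * ε ≤ u}.image (· + ε))

theorem add_mem_cuts (hx : x ∈ T) (h : ∀ u ∈ T, x < u → x + 3 * ε ≤ u) : x + ε ∈ cuts T ε :=
  Finset.mem_insert_of_mem (Finset.mem_image_of_mem _ (Finset.mem_filter.2 ⟨hx, h⟩))

theorem notMem_Ico_of_mem_cuts (hε : 0 < ε) (hT : ∀ u ∈ T, 0 ≤ u) {g : ℝ} (hg : g ∈ cuts T ε) :
    ∀ u ∈ T, u ∉ Set.Ico g (g + 2 * ε) := by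
  rintro u hu ⟨hgu, hug⟩
  rcases Finset.mem_insert.1 hg with rfl | hg
  · linarith [hT u hu]
  · obtain ⟨x, hx, rfl⟩ := Finset.mem_image.1 hg
    linarith [(Finset.mem_filter.1 hx).2 u hu (by linarith)]

theorem abs_sub_le_of_cutIndex_eq (hε : 0 < ε) (hx : x ∈ T) (hy : y ∈ T)
    (h : cutIndex (cuts T ε) x = cutIndex (cuts T ε) y) : |x - y| ≤ 3 * ε * T.card := by
  wlog hxy : x ≤ y generalizing x y
  · rw [abs_sub_comm]
    exact this hy hx h.symm (le_of_not_ge hxy)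
  rw [abs_sub_comm, abs_of_nonneg (sub_nonneg.2 hxy)]
  refine (sub_le_mul_card (η := 3 * ε) (by positivity) hx hxy fun u hu hxu huy => ?_).trans
    (by gcongr; exact Finset.filter_subset _ _)
  by_contra! no_point
  exact (cutIndex_lt (add_mem_cuts hu no_point) (by linarith)
    (by linarith [no_point y hy huy])).ne h

theorem exists_mem_cuts_le (hε : 0 < ε) (hx : 0 ≤ x) : ∃ g ∈ cuts T ε, g ≤ x :=
  ⟨-2 * ε, Finset.mem_insert_self _ _, by linarith⟩

theorem exists_mem_cuts_lt (hε : 0 < ε) (hx : x ∈ T) : ∃ g ∈ cuts T ε, x < g :=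
  ⟨T.max' ⟨x, hx⟩ + ε, add_mem_cuts (T.max'_mem _) fun u hu h => absurd (T.le_max' u hu) h.not_ge,
    by linarith [T.le_max' x hx]⟩

end Cuts

/-! ### Stability of diagrams -/

section Stability

variable (F : Type*) [Field F] (d : ℕ) {E : Type*} [MetricSpace E]

theorem diagram_apply_eq_zero {S : Set E} [Finite S] {T : Finset ℝ} (hT : distances S ⊆ T)
    {A : Set (ℝ × ℝ)} (hA : ∀ z ∈ A, z.1 ∉ T ∨ z.2 ∉ T) : diagram F d S A = 0 := by
  refine measure_mono_null (fun z hz => ?_) (ae_iff.1 (ae_mem_distances_diagram F d (S := S)))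
  rintro ⟨h₁, h₂, -⟩
  exact (hA z hz).elim (· (hT h₁)) (· (hT h₂))

theorem diagram_box_eq {S S' : Set E} [Finite S] [Finite S'] {T G : Finset ℝ}
    (hS : distances S ⊆ T) (hS' : distances S' ⊆ T)
    (hG : ∀ x ∈ T, (∃ g ∈ G, g ≤ x) ∧ ∃ g ∈ G, x < g)
    (hbetti : ∀ s ∈ G, ∀ t ∈ G, s ≤ t → persistentBetti F d S s t = persistentBetti F d S' s t)
    {i j : Fin (G.card + 1)} (hij : i < j) :
    diagram F d S (Prod.map (cutIndex G) (cutIndex G) ⁻¹' {(i, j)}) =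
      diagram F d S' (Prod.map (cutIndex G) (cutIndex G) ⁻¹' {(i, j)}) := by
  rw [← Set.singleton_prod_singleton, Set.preimage_prod_map_prod]
  by_cases hne : (∃ x ∈ T, cutIndex G x = i) ∧ ∃ y ∈ T, cutIndex G y = j
  · obtain ⟨⟨x, hx, rfl⟩, y, hy, rfl⟩ := hne
    obtain ⟨a, ha, b, hb, hxab, fibre_x⟩ :=
      exists_preimage_cutIndex_eq_Ico (hG x hx).1 (hG x hx).2
    obtain ⟨c, hc, e, he, hyce, fibre_y⟩ :=
      exists_preimage_cutIndex_eq_Ico (hG y hy).1 (hG y hy).2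
    have hab : a ≤ b := hxab.1.trans hxab.2.le
    have hce : c ≤ e := hyce.1.trans hyce.2.le
    have hbc : b ≤ c := by
      have index_c : cutIndex G c = cutIndex G y :=
        fibre_y.ge (Set.left_mem_Ico.2 (hyce.1.trans_lt hyce.2))
      have hxc : x < c := (cutIndex_mono G).reflect_lt (index_c ▸ hij)
      by_contra! hcb
      have index_c' : cutIndex G c = cutIndex G x := fibre_x.ge ⟨hxab.1.trans hxc.le, hcb⟩
      exact hij.ne (index_c'.symm.trans index_c)
    rw [fibre_x, fibre_y, diagram_Ico_prod_Ico F d hab hbc hce,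
      diagram_Ico_prod_Ico F d hab hbc hce]
    unfold rectangleCount
    rw [hbetti b hb c hc hbc, hbetti a ha c hc (hab.trans hbc), hbetti b hb e he (hbc.trans hce),
      hbetti a ha e he (hab.trans (hbc.trans hce))]
  · have notMem : ∀ z ∈ (cutIndex G ⁻¹' {i}) ×ˢ (cutIndex G ⁻¹' {j}), z.1 ∉ T ∨ z.2 ∉ T := by
      rintro z ⟨h₁, h₂⟩
      by_contra! hz
      exact hne ⟨⟨z.1, hz.1, h₁⟩, z.2, hz.2, h₂⟩
    rw [diagram_apply_eq_zero F d hS notMem, diagram_apply_eq_zero F d hS' notMem]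

theorem exists_retraction {X S : Set E} (hSX : S ⊆ X) {ε : ℝ} (hε : 0 ≤ ε)
    (hdense : ∀ x ∈ X, ∃ y ∈ S, dist y x ≤ ε) :
    ∃ φ : X → S, Function.LeftInverse φ (Set.inclusion hSX) ∧
      ∀ x, dist (Set.inclusion hSX (φ x)) x ≤ ε := by
  have exists_near (x : X) : ∃ y : S, dist (y : E) x ≤ ε ∧ ((x : E) ∈ S → (y : E) = x) := by
    by_cases hx : (x : E) ∈ S
    · exact ⟨⟨x, hx⟩, (dist_self _).trans_le hε, fun _ => rfl⟩
    · obtain ⟨y, hy, hyx⟩ := hdense x x.2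
      exact ⟨⟨y, hy⟩, hyx, fun h => absurd h hx⟩
  choose φ dist_φ φ_eq using exists_near
  exact ⟨φ, fun s => Subtype.ext (φ_eq (Set.inclusion hSX s) s.2), dist_φ⟩

/-- The stability constant of diagrams of subsets of a set of `N` points: their distances are
covered by clusters of length at most `3 * N ^ 2` times the scale, and each of the two diagrams has
mass at most `2 * N ^ (d + 5)`. -/
def stabilityConst (d : ℕ) (p : ℝ) (N : ℕ) : ℝ := 2 * (3 * N ^ 2) ^ p * (4 * N ^ (d + 5))

theorem stabilityConst_nonneg (d : ℕ) (p : ℝ) (N : ℕ) : 0 ≤ stabilityConst d p N := by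
  unfold stabilityConst
  positivity

theorem distances_subset {X S : Set E} [Finite X] [Finite S] (h : S ⊆ X) :
    distances S ⊆ distances X := by
  intro r hr
  obtain ⟨u, v, rfl⟩ := mem_distances.1 hr
  exact dist_mem_distances (Set.inclusion h u) (Set.inclusion h v)

variable {X : Finset E} {S : Set E} {p ε : ℝ}

theorem diagram_univ_add_le (hSX : S ⊆ X) :
    diagram F d S Set.univ + diagram F d (X : Set E) Set.univ ≤
      ENNReal.ofReal (4 * X.card ^ (d + 5)) := by
  have : Finite S := (X.finite_toSet.subset hSX).to_subtype
  have card_X : Nat.card X = X.card := Nat.card_eq_finsetCard X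
  have card_S : Nat.card S ≤ X.card := card_X ▸ Nat.card_mono X.finite_toSet hSX
  calc
    diagram F d S Set.univ + diagram F d (X : Set E) Set.univ
      ≤ 2 * Nat.card S ^ (d + 5) + 2 * Nat.card X ^ (d + 5) :=
        add_le_add (diagram_univ_le F d) (diagram_univ_le F d)
    _ ≤ 2 * X.card ^ (d + 5) + 2 * X.card ^ (d + 5) := by
        rw [card_X]
        gcongr
    _ = ENNReal.ofReal (4 * X.card ^ (d + 5)) := by
        rw [← add_mul, ENNReal.ofReal_mul (by norm_num), ENNReal.ofReal_pow (by positivity),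
          ENNReal.ofReal_natCast]
        norm_num

theorem two_mul_rpow_mul_le_stabilityConst (d : ℕ) (hp : 0 < p) (hε : 0 ≤ ε) :
    2 * (3 * ε * (distances (X : Set E)).card) ^ p * (4 * X.card ^ (d + 5)) ≤
      stabilityConst d p X.card * ε ^ p := by
  have card_le : ((distances (X : Set E)).card : ℝ) ≤ X.card ^ 2 := by
    exact_mod_cast (Nat.card_eq_finsetCard X) ▸ card_distances_le (V := (X : Set E))
  calc
    2 * (3 * ε * (distances (X : Set E)).card) ^ p * (4 * X.card ^ (d + 5))
      ≤ 2 * (3 * ε * X.card ^ 2) ^ p * (4 * X.card ^ (d + 5)) := by gcongr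
    _ = stabilityConst d p X.card * ε ^ p := by
        rw [mul_right_comm 3, Real.mul_rpow (by positivity) hε, stabilityConst]
        ring

theorem OT_diagram_rpow_le_of_pos (hp : 0 < p) (hSX : S ⊆ X) (hε : 0 < ε)
    (hdense : ∀ x ∈ X, ∃ y ∈ S, dist y x ≤ ε) :
    OT p (diagram F d S) (diagram F d (X : Set E)) ^ p ≤
      ENNReal.ofReal (stabilityConst d p X.card * ε ^ p) := by
  have : Finite S := (X.finite_toSet.subset hSX).to_subtype
  obtain ⟨φ, hφ, dist_φ⟩ := exists_retraction hSX hε.le hdense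
  set T := distances (X : Set E)
  have hST : distances S ⊆ T := distances_subset hSX
  have nonneg : ∀ u ∈ T, 0 ≤ u := by
    intro u hu
    obtain ⟨v, w, rfl⟩ := mem_distances.1 hu
    exact dist_nonneg
  have ripsComplex_eq_add {V : Set E} [Finite V] (hV : distances V ⊆ T) {g : ℝ}
      (hg : g ∈ cuts T ε) : ripsComplex V g = ripsComplex V (g + 2 * ε) :=
    ripsComplex_eq_of_disjoint hV (by linarith) (notMem_Ico_of_mem_cuts hε nonneg hg)
  have betti_eq : ∀ s ∈ cuts T ε, ∀ t ∈ cuts T ε, s ≤ t →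
      persistentBetti F d S s t = persistentBetti F d (X : Set E) s t := fun s hs t ht hst =>
    persistentBetti_eq_of_retraction F d (i := Set.inclusion hSX)
      (Isometry.of_dist_eq fun _ _ => rfl) hφ hε.le dist_φ hst
      (ripsComplex_eq_add subset_rfl hs) (ripsComplex_eq_add hST hs) (ripsComplex_eq_add hST ht)
  have ae_mem {V : Set E} [Finite V] (hV : distances V ⊆ T) :
      ∀ᵐ z ∂diagram F d V, z.1 ∈ T ∧ z.2 ∈ T ∧ z.1 < z.2 :=
    (ae_mem_distances_diagram F d).mono fun z hz => ⟨hV hz.1, hV hz.2.1, hz.2.2⟩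
  have OT_le := OT_rpow_le_of_measure_box_eq hp (cutIndex_mono _)
    (fun x hx y hy => abs_sub_le_of_cutIndex_eq hε hx hy) (ae_mem hST) (ae_mem subset_rfl)
    fun i j => diagram_box_eq F d hST subset_rfl
      (fun x hx => ⟨exists_mem_cuts_le hε (nonneg x hx), exists_mem_cuts_lt hε hx⟩) betti_eq
  refine (OT_le.trans (mul_le_mul_right (diagram_univ_add_le F d hSX) _)).trans ?_
  rw [← ENNReal.ofReal_mul (by positivity)]
  exact ENNReal.ofReal_le_ofReal (two_mul_rpow_mul_le_stabilityConst d hp hε.le)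

theorem OT_diagram_rpow_le (hp : 0 < p) (hSX : S ⊆ X) (hε : 0 ≤ ε)
    (hdense : ∀ x ∈ X, ∃ y ∈ S, dist y x ≤ ε) :
    OT p (diagram F d S) (diagram F d (X : Set E)) ^ p ≤
      ENNReal.ofReal (stabilityConst d p X.card * ε ^ p) := by
  have tendsto : Filter.Tendsto (fun δ : ℝ => ENNReal.ofReal (stabilityConst d p X.card * δ ^ p))
      (nhdsWithin ε (Set.Ioi ε)) (nhds (ENNReal.ofReal (stabilityConst d p X.card * ε ^ p))) := by
    refine (Continuous.tendsto ?_ ε).mono_left nhdsWithin_le_nhds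
    exact ENNReal.continuous_ofReal.comp (continuous_const.mul (Real.continuous_rpow_const hp.le))
  refine ge_of_tendsto tendsto ?_
  filter_upwards [self_mem_nhdsWithin] with δ hδ
  exact OT_diagram_rpow_le_of_pos F d hp hSX (hε.trans_lt hδ) fun x hx =>
    (hdense x hx).imp fun y hy => ⟨hy.1, hy.2.trans (le_of_lt hδ)⟩

end Stability

/-! ### Moments of the covering radius -/

section Moments

variable {p b c r : ℝ}

theorem ofReal_mul_lintegral_Ioc_rpow (hp : 0 < p) (hr : 0 ≤ r) :
    ENNReal.ofReal p * ∫⁻ t in Set.Ioc 0 r, ENNReal.ofReal (t ^ (p - 1)) =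
      ENNReal.ofReal (r ^ p) := by
  have integrable : IntervalIntegrable (fun t : ℝ => t ^ (p - 1)) volume 0 r :=
    intervalIntegral.intervalIntegrable_rpow' (by linarith)
  rw [← ofReal_integral_eq_lintegral_ofReal
      ((intervalIntegrable_iff_integrableOn_Ioc_of_le hr).1 integrable)
      ((ae_restrict_mem measurableSet_Ioc).mono fun t ht => Real.rpow_nonneg ht.1.le _),
    ← intervalIntegral.integral_of_le hr, integral_rpow (Or.inl (by linarith)), sub_add_cancel,
    Real.zero_rpow hp.ne', sub_zero, ← ENNReal.ofReal_mul hp.le, mul_div_cancel₀ _ hp.ne']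

theorem ofReal_mul_lintegral_Ioi_exp_mul_rpow_le (hp : 0 < p) (hb : 0 < b) (hc : 0 < c)
    (hr : 0 ≤ r) :
    ENNReal.ofReal p *
        ∫⁻ t in Set.Ioi r, ENNReal.ofReal (Real.exp (-(c * t ^ b)) * t ^ (p - 1)) ≤
      ENNReal.ofReal
        (Real.Gamma (p / b + 1) * (c / 2) ^ (-(p / b)) * Real.exp (-(c * r ^ b / 2))) := by
  have exp_le {t : ℝ} (ht : r < t) : Real.exp (-(c * t ^ b)) ≤
      Real.exp (-(c * r ^ b / 2)) * Real.exp (-(c / 2) * t ^ b) := by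
    rw [← Real.exp_add, Real.exp_le_exp]
    have : c * r ^ b ≤ c * t ^ b := by gcongr
    linarith
  have integral_eq := integral_rpow_mul_exp_neg_mul_rpow (q := p - 1) hb (by linarith) (half_pos hc)
  rw [sub_add_cancel, neg_div] at integral_eq
  have integrable := integrableOn_rpow_mul_exp_neg_mul_rpow (s := p - 1) (by linarith) hb
    (half_pos hc)
  calc
    ENNReal.ofReal p *
        ∫⁻ t in Set.Ioi r, ENNReal.ofReal (Real.exp (-(c * t ^ b)) * t ^ (p - 1))
      ≤ ENNReal.ofReal p * ∫⁻ t in Set.Ioi 0, ENNReal.ofReal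
          (Real.exp (-(c * r ^ b / 2)) * (t ^ (p - 1) * Real.exp (-(c / 2) * t ^ b))) := by
        refine mul_le_mul_right (le_trans (setLIntegral_mono' measurableSet_Ioi fun t ht => ?_)
          (lintegral_mono_set (Set.Ioi_subset_Ioi hr))) _
        have t_nonneg : 0 ≤ t := hr.trans (le_of_lt ht)
        refine ENNReal.ofReal_le_ofReal ?_
        rw [mul_left_comm, mul_comm (Real.exp _)]
        gcongr
        exact exp_le ht
    _ = ENNReal.ofReal
        (Real.Gamma (p / b + 1) * (c / 2) ^ (-(p / b)) * Real.exp (-(c * r ^ b / 2))) := by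
        rw [← ofReal_integral_eq_lintegral_ofReal (integrable.const_mul _)
          ((ae_restrict_mem measurableSet_Ioi).mono fun t (ht : 0 < t) => by positivity),
          integral_const_mul, integral_eq, ← ENNReal.ofReal_mul hp.le,
          Real.Gamma_add_one (by positivity)]
        ring_nf

theorem lintegral_rpow_le_of_tail_le {Ω : Type*} [MeasurableSpace Ω] {μ : Measure Ω}
    [IsProbabilityMeasure μ] {Y : Ω → ℝ} (hY : 0 ≤ Y) (hYm : AEMeasurable Y μ) {K : ℝ} (hK : 0 ≤ K)
    (hp : 0 < p) (hb : 0 < b) (hc : 0 < c) (hr : 0 ≤ r)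
    (tail : ∀ t, r < t → μ {ω | t < Y ω} ≤ ENNReal.ofReal (K * Real.exp (-(c * t ^ b)))) :
    ∫⁻ ω, ENNReal.ofReal (Y ω ^ p) ∂μ ≤ ENNReal.ofReal (r ^ p + K *
      (Real.Gamma (p / b + 1) * (c / 2) ^ (-(p / b)) * Real.exp (-(c * r ^ b / 2)))) := by
  have head_le : ∫⁻ t in Set.Ioc 0 r, μ {ω | t < Y ω} * ENNReal.ofReal (t ^ (p - 1)) ≤
      ∫⁻ t in Set.Ioc 0 r, ENNReal.ofReal (t ^ (p - 1)) :=
    lintegral_mono fun t => mul_le_of_le_one_left zero_le prob_le_one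
  have tail_le : ∫⁻ t in Set.Ioi r, μ {ω | t < Y ω} * ENNReal.ofReal (t ^ (p - 1)) ≤
      ENNReal.ofReal K *
        ∫⁻ t in Set.Ioi r, ENNReal.ofReal (Real.exp (-(c * t ^ b)) * t ^ (p - 1)) := by
    rw [← lintegral_const_mul' _ _ ENNReal.ofReal_ne_top]
    refine setLIntegral_mono' measurableSet_Ioi fun t ht => ?_
    rw [← ENNReal.ofReal_mul hK, ← mul_assoc, ENNReal.ofReal_mul (by positivity)]
    exact mul_le_mul_left (tail t ht) _
  rw [lintegral_rpow_eq_lintegral_meas_lt_mul _ (.of_forall hY) hYm hp,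
    ← Set.Ioc_union_Ioi_eq_Ioi hr]
  refine (mul_le_mul_right ((lintegral_union_le _ _ _).trans (add_le_add head_le tail_le)) _).trans
    ?_
  rw [mul_add, ofReal_mul_lintegral_Ioc_rpow hp hr, mul_left_comm,
    ENNReal.ofReal_add (by positivity) (by positivity), ENNReal.ofReal_mul hK]
  gcongr
  exact ofReal_mul_lintegral_Ioi_exp_mul_rpow_le hp hb hc hr

end Moments

section CoveringRadius

variable {ι M : Type*} [PseudoMetricSpace M]

/-- The smallest `r` such that every point is within distance `r` of the sample `s`. -/
def coveringRadius (s : ι → M) : ℝ := ⨆ x : M, ⨅ j, dist (s j) x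

theorem coveringRadius_nonneg (s : ι → M) : 0 ≤ coveringRadius s :=
  Real.iSup_nonneg fun _ => Real.iInf_nonneg fun _ => dist_nonneg

theorem exists_dist_le_coveringRadius [Finite ι] [Nonempty ι] [Finite M] (s : ι → M) (x : M) :
    ∃ j, dist (s j) x ≤ coveringRadius s := by
  obtain ⟨j, hj⟩ := exists_eq_ciInf_of_finite (f := fun j => dist (s j) x)
  exact ⟨j, hj.le.trans (le_ciSup (f := fun x => ⨅ j, dist (s j) x)
    (Set.finite_range _).bddAbove x)⟩

theorem exists_lt_dist_of_lt_coveringRadius [Finite ι] [Nonempty M] {s : ι → M} {r : ℝ}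
    (h : r < coveringRadius s) : ∃ x, ∀ j, r < dist (s j) x := by
  obtain ⟨x, hx⟩ := exists_lt_of_lt_ciSup h
  exact ⟨x, fun j => hx.trans_le (ciInf_le (Set.finite_range _).bddBelow j)⟩

theorem measurable_coveringRadius [Countable ι] [Countable M] [MeasurableSpace M]
    [OpensMeasurableSpace M] : Measurable (coveringRadius : (ι → M) → ℝ) :=
  .iSup fun _ => .iInf fun j => (measurable_pi_apply j).dist measurable_const

variable [MeasurableSpace M] [OpensMeasurableSpace M] {π : Measure M} [IsProbabilityMeasure π]
  {a b r₀ : ℝ}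

theorem measure_compl_ball_le (h : StandardAssumption π a b r₀) (x : M) {r : ℝ}
    (hr : r₀ < r) :
    π (Metric.ball x r)ᶜ ≤ ENNReal.ofReal (Real.exp (-(a * r ^ b))) := by
  have a_pos := h.a_pos
  have r_nonneg : 0 ≤ r := h.r₀_nonneg.trans hr.le
  have one_le : 1 ≤ Real.exp (-(a * r ^ b)) + min 1 (a * r ^ b) := by
    rcases min_choice 1 (a * r ^ b) with hmin | hmin <;> rw [hmin]
    · linarith [Real.exp_pos (-(a * r ^ b))]
    · linarith [Real.one_sub_le_exp_neg (a * r ^ b)]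
  rw [prob_compl_eq_one_sub measurableSet_ball, tsub_le_iff_right]
  calc
    (1 : ℝ≥0∞) ≤ ENNReal.ofReal (Real.exp (-(a * r ^ b)) + min 1 (a * r ^ b)) := by
      simpa using ENNReal.ofReal_le_ofReal one_le
    _ ≤ ENNReal.ofReal (Real.exp (-(a * r ^ b))) + π (Metric.ball x r) := by
      rw [ENNReal.ofReal_add (by positivity) (by positivity)]
      gcongr
      exact h.le_measure_ball x r hr

variable [Fintype ι] [Finite M]

theorem measure_lt_coveringRadius_le (h : StandardAssumption π a b r₀) {r : ℝ} (hr : r₀ < r) :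
    Measure.pi (fun _ : ι => π) {s | r < coveringRadius s} ≤
      ENNReal.ofReal (Nat.card M * Real.exp (-(a * Fintype.card ι * r ^ b))) := by
  have := Fintype.ofFinite M
  have : Nonempty M := nonempty_of_isProbabilityMeasure π
  have subset_iUnion : {s : ι → M | r < coveringRadius s} ⊆
      ⋃ x : M, Set.univ.pi fun _ : ι => (Metric.ball x r)ᶜ := by
    intro s hs
    obtain ⟨x, hx⟩ := exists_lt_dist_of_lt_coveringRadius hs
    exact Set.mem_iUnion.2 ⟨x, fun j _ => by simpa using (hx j).le⟩
  have miss_le (x : M) : Measure.pi (fun _ : ι => π) (Set.univ.pi fun _ => (Metric.ball x r)ᶜ) ≤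
      ENNReal.ofReal (Real.exp (-(a * Fintype.card ι * r ^ b))) := by
    rw [Measure.pi_pi, Finset.prod_const, Finset.card_univ]
    refine (pow_le_pow_left₀ zero_le (measure_compl_ball_le h x hr) _).trans_eq ?_
    rw [← ENNReal.ofReal_pow (Real.exp_nonneg _), ← Real.exp_nat_mul]
    ring_nf
  calc
    Measure.pi (fun _ : ι => π) {s | r < coveringRadius s}
      ≤ ∑ x : M, Measure.pi (fun _ : ι => π) (Set.univ.pi fun _ => (Metric.ball x r)ᶜ) :=
        (measure_mono subset_iUnion).trans (measure_iUnion_fintype_le _ _)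
    _ ≤ ∑ _x : M, ENNReal.ofReal (Real.exp (-(a * Fintype.card ι * r ^ b))) :=
        Finset.sum_le_sum fun x _ => miss_le x
    _ = ENNReal.ofReal (Nat.card M * Real.exp (-(a * Fintype.card ι * r ^ b))) := by
        rw [Finset.sum_const, Finset.card_univ, nsmul_eq_mul, ENNReal.ofReal_mul (by positivity),
          ENNReal.ofReal_natCast, Nat.card_eq_fintype_card]

theorem lintegral_coveringRadius_rpow_le [Nonempty ι] (h : StandardAssumption π a b r₀) {p : ℝ}
    (hp : 0 < p) :
    ∫⁻ s, ENNReal.ofReal (coveringRadius s ^ p) ∂Measure.pi (fun _ : ι => π) ≤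
      ENNReal.ofReal (r₀ ^ p + Nat.card M * (Real.Gamma (p / b + 1) *
        (a * Fintype.card ι / 2) ^ (-(p / b)) *
          Real.exp (-(a * Fintype.card ι * r₀ ^ b / 2)))) := by
  have a_pos := h.a_pos
  exact lintegral_rpow_le_of_tail_le coveringRadius_nonneg
    measurable_coveringRadius.aemeasurable (Nat.cast_nonneg _) hp h.b_pos (by positivity)
    h.r₀_nonneg fun t ht => measure_lt_coveringRadius_le h ht

end CoveringRadius

/-! ### The approximation error -/

section ApproximationError

variable (F : Type*) [Field F] (d : ℕ) {p : ℝ} {E : Type*} [MetricSpace E] {X : Finset E} {B n : ℕ}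

theorem OT_meanMeasure_rpow_le [NeZero n] (hp : 0 < p) (hB : B ≠ 0) (S : Fin B → Fin n → X) :
    OT p (meanMeasure F d fun i j => (S i j : E)) (diagram F d (X : Set E)) ^ p ≤
      (B : ℝ≥0∞)⁻¹ *
        ∑ i, ENNReal.ofReal (stabilityConst d p X.card * coveringRadius (S i) ^ p) := by
  refine (OT_average_rpow_le hp hB _ _).trans ?_
  gcongr with i
  refine OT_diagram_rpow_le F d hp (Set.range_subset_iff.2 fun j => (S i j).2)
    (coveringRadius_nonneg _) fun x hx => ?_
  obtain ⟨j, hj⟩ := exists_dist_le_coveringRadius (S i) ⟨x, hx⟩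
  exact ⟨S i j, ⟨j, rfl⟩, hj⟩

variable [MeasurableSpace E] [OpensMeasurableSpace E] {a b r₀ : ℝ} {π : Measure X}
  {Ω : Type*} [MeasurableSpace Ω] {P : Measure Ω} {S : Fin B → Ω → Fin n → X}

theorem approximationError_le_lintegral_coveringRadius [NeZero n] (hp : 0 < p) (hB : B ≠ 0)
    (hS : ∀ i, HasLaw (S i) (Measure.pi fun _ : Fin n => π) P) :
    approximationError F d p X P S ≤ ENNReal.ofReal (stabilityConst d p X.card) *
      ∫⁻ s, ENNReal.ofReal (coveringRadius s ^ p) ∂Measure.pi fun _ : Fin n => π := by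
  set Y : (Fin n → X) → ℝ≥0∞ := fun s =>
    ENNReal.ofReal (stabilityConst d p X.card * coveringRadius s ^ p)
  have measurable_Y : Measurable Y :=
    ((measurable_coveringRadius.pow_const p).const_mul _).ennreal_ofReal
  have lintegral_Y (i : Fin B) :
      ∫⁻ ω, Y (S i ω) ∂P = ∫⁻ s, Y s ∂Measure.pi fun _ : Fin n => π := by
    rw [← (hS i).map_eq, lintegral_map' measurable_Y.aemeasurable (hS i).aemeasurable]
  have lintegral_sum : ∫⁻ ω, ∑ i, Y (S i ω) ∂P = ∑ i, ∫⁻ ω, Y (S i ω) ∂P :=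
    lintegral_finsetSum' _ fun i _ => measurable_Y.comp_aemeasurable (hS i).aemeasurable
  calc
    approximationError F d p X P S ≤ ∫⁻ ω, (B : ℝ≥0∞)⁻¹ * ∑ i, Y (S i ω) ∂P :=
      lintegral_mono fun ω => OT_meanMeasure_rpow_le F d hp hB fun i => S i ω
    _ = ∫⁻ s, Y s ∂Measure.pi fun _ : Fin n => π := by
      rw [lintegral_const_mul' _ _ (ENNReal.inv_ne_top.2 (Nat.cast_ne_zero.2 hB)),
        lintegral_sum, Finset.sum_congr rfl fun i _ => lintegral_Y i, Finset.sum_const,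
        Finset.card_univ, Fintype.card_fin, nsmul_eq_mul,
        ENNReal.inv_mul_cancel_left (Nat.cast_ne_zero.2 hB) (ENNReal.natCast_ne_top B)]
    _ = ENNReal.ofReal (stabilityConst d p X.card) *
        ∫⁻ s, ENNReal.ofReal (coveringRadius s ^ p) ∂Measure.pi fun _ : Fin n => π := by
      simp only [Y, ENNReal.ofReal_mul (stabilityConst_nonneg d p X.card)]
      exact lintegral_const_mul _ (measurable_coveringRadius.pow_const p).ennreal_ofReal

/-- The constant in front of the rate. The last factor absorbs the constants lost in comparing
`n ^ (-(p / b)) * exp (-(a * n * r₀ ^ b / 2))` with each of the three rates. -/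
def rateConst (d : ℕ) (p : ℝ) (N : ℕ) (a b : ℝ) : ℝ :=
  stabilityConst d p N * (N * (Real.Gamma (p / b + 1) * (a / 2) ^ (-(p / b)))) *
    (16 * 2 ^ (p / b))

theorem approximationError_le [NeZero n] [IsProbabilityMeasure π] (hp : 0 < p)
    (h : StandardAssumption π a b r₀) (hB : B ≠ 0)
    (hS : ∀ i, HasLaw (S i) (Measure.pi fun _ : Fin n => π) P) {ρ : ℝ}
    (hρ : (n : ℝ) ^ (-(p / b)) * Real.exp (-(a * n * r₀ ^ b / 2)) ≤ 16 * 2 ^ (p / b) * ρ) :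
    approximationError F d p X P S ≤
      ENNReal.ofReal (stabilityConst d p X.card * r₀ ^ p + rateConst d p X.card a b * ρ) := by
  have a_pos := h.a_pos
  have b_pos := h.b_pos
  have const_nonneg := stabilityConst_nonneg d p X.card
  refine (approximationError_le_lintegral_coveringRadius F d hp hB hS).trans <|
    (mul_le_mul_right (lintegral_coveringRadius_rpow_le h hp) _).trans ?_
  rw [← ENNReal.ofReal_mul const_nonneg, Nat.card_eq_finsetCard, Fintype.card_fin]
  refine ENNReal.ofReal_le_ofReal ?_
  rw [mul_div_right_comm, Real.mul_rpow (by positivity) (by positivity), mul_add, rateConst]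
  linear_combination stabilityConst d p X.card *
    (X.card * (Real.Gamma (p / b + 1) * (a / 2) ^ (-(p / b)))) * hρ

end ApproximationError

/-! ### Comparison of rates -/

section Rates

variable {a b q r x : ℝ}

theorem half_le_log (hx : 2 ≤ x) : 1 / 2 ≤ Real.log x := by
  have : Real.log 2 ≤ Real.log x := by gcongr
  linarith [Real.log_two_gt_d9]

theorem rpow_neg_le_log_div_rpow (hq : 0 ≤ q) (hx : 2 ≤ x) :
    x ^ (-q) ≤ 2 ^ q * (Real.log x / x) ^ q := by
  have log_ge := half_le_log hx
  rw [Real.rpow_neg_eq_inv_rpow, ← Real.mul_rpow (by norm_num) (by positivity), ← mul_div_assoc,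
    inv_eq_one_div]
  gcongr
  linarith

theorem sq_log_le (hx : 1 ≤ x) : Real.log x ^ 2 ≤ 16 * x ^ (1 / 2 : ℝ) := by
  have x_nonneg : 0 ≤ x := by linarith
  have log_nonneg := Real.log_nonneg hx
  calc
    Real.log x ^ 2 ≤ (x ^ (1 / 4 : ℝ) / (1 / 4)) ^ 2 := by
      gcongr
      exact Real.log_le_rpow_div x_nonneg (by norm_num)
    _ = 16 * x ^ (1 / 2 : ℝ) := by
      rw [div_pow, ← Real.rpow_mul_natCast x_nonneg]
      norm_num
      ring

theorem exp_le_rpow_neg_half (ha : 0 < a) (hb : 0 < b) (hx : 1 ≤ x)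
    (hr : (Real.log x / (a * x)) ^ (1 / b) ≤ r) :
    Real.exp (-(a * x * r ^ b / 2)) ≤ x ^ (-(1 / 2) : ℝ) := by
  have x_pos : 0 < x := by linarith
  have log_nonneg := Real.log_nonneg hx
  have log_div_le : Real.log x / (a * x) ≤ r ^ b := by
    rw [one_div] at hr
    exact (Real.rpow_inv_le_iff_of_pos (by positivity) (le_trans (by positivity) hr) hb).1 hr
  rw [div_le_iff₀ (by positivity)] at log_div_le
  rw [Real.rpow_def_of_pos x_pos, Real.exp_le_exp]
  linarith

theorem rpow_neg_half_le (hx : 2 ≤ x) : x ^ (-(1 / 2) : ℝ) ≤ 16 * (1 / Real.log x ^ 2) := by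
  have log_ge := half_le_log hx
  rw [Real.rpow_neg (by positivity), mul_one_div, inv_le_comm₀ (by positivity) (by positivity),
    inv_div, div_le_iff₀' (by norm_num)]
  exact sq_log_le (by linarith)

theorem rpow_neg_mul_le_rpow_neg_sub_one {e : ℝ} (hq : 0 ≤ q) (hx : 1 ≤ x) (he : e ≤ 1) :
    x ^ (-q) * e ≤ 16 * 2 ^ q * x ^ (-(q - 1)) := by
  have one_le : (1 : ℝ) ≤ 16 * 2 ^ q := by
    linarith [Real.one_le_rpow (one_le_two (α := ℝ)) hq]
  calc
    x ^ (-q) * e ≤ x ^ (-q) := mul_le_of_le_one_right (by positivity) he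
    _ ≤ x ^ (-(q - 1)) := Real.rpow_le_rpow_of_exponent_le hx (by linarith)
    _ ≤ 16 * 2 ^ q * x ^ (-(q - 1)) := le_mul_of_one_le_left (by positivity) one_le

theorem rpow_neg_mul_le_log_div_rpow {e : ℝ} (hr : 0 ≤ r) (hrq : r ≤ q) (hx : 2 ≤ x)
    (he : e ≤ 1) : x ^ (-q) * e ≤ 16 * 2 ^ q * (Real.log x / x) ^ r := by
  have log_ge := half_le_log hx
  calc
    x ^ (-q) * e ≤ x ^ (-q) := mul_le_of_le_one_right (by positivity) he
    _ ≤ x ^ (-r) := Real.rpow_le_rpow_of_exponent_le (by linarith) (by linarith)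
    _ ≤ 2 ^ r * (Real.log x / x) ^ r := rpow_neg_le_log_div_rpow hr hx
    _ ≤ 2 ^ q * (Real.log x / x) ^ r := by
      gcongr
      exact one_le_two
    _ ≤ 16 * 2 ^ q * (Real.log x / x) ^ r := by
      gcongr
      exact le_mul_of_one_le_left (by positivity) (by norm_num)

theorem rpow_neg_mul_le_log_div_rpow_mul {e : ℝ} (hq : 0 ≤ q) (hx : 2 ≤ x)
    (he : e ≤ x ^ (-(1 / 2) : ℝ)) :
    x ^ (-q) * e ≤ 16 * 2 ^ q * ((Real.log x / x) ^ q * (1 / Real.log x ^ 2)) := by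
  have log_ge := half_le_log hx
  calc
    x ^ (-q) * e ≤ (2 ^ q * (Real.log x / x) ^ q) * (16 * (1 / Real.log x ^ 2)) := by
      refine (mul_le_mul_of_nonneg_left (he.trans (rpow_neg_half_le hx)) (by positivity)).trans ?_
      gcongr
      exact rpow_neg_le_log_div_rpow hq hx
    _ = 16 * 2 ^ q * ((Real.log x / x) ^ q * (1 / Real.log x ^ 2)) := by ring

end Rates

end MeanPersistence

end

open MeanPersistence in
theorem theorem4p3_general {F : Type*} [Field F] (d : ℕ) (p : ℝ) (hp : 1 ≤ p) (N : ℕ) :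
    ∃ (C₂ : ℝ) (C₃ : ℝ → ℝ → ℝ),
      ∀ {E : Type*} [MetricSpace E] [MeasurableSpace E] [OpensMeasurableSpace E] (X : Finset E),
        X.card = N → ∀ (a b r₀ : ℝ) (π : Measure X) [IsProbabilityMeasure π],
          StandardAssumption π a b r₀ →
          ∀ (n B : ℕ), 1 ≤ n → 1 ≤ B →
          ∀ {Ω : Type*} [MeasurableSpace Ω] (P : Measure Ω) (S : Fin B → Ω → Fin n → X),
            (∀ i, HasLaw (S i) (Measure.pi fun _ : Fin n => π) P) →
            approximationError F d p X P S ≤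
                ENNReal.ofReal (C₂ * r₀ ^ p + C₃ a b * (n : ℝ) ^ (-(p / b - 1))) ∧
            (2 ≤ n → approximationError F d p X P S ≤
                ENNReal.ofReal (C₂ * r₀ ^ p + C₃ a b * (Real.log n / n) ^ (1 / b))) ∧
            (2 ≤ n → (Real.log n / (a * n)) ^ (1 / b) ≤ r₀ →
              approximationError F d p X P S ≤ ENNReal.ofReal (C₂ * r₀ ^ p
                + C₃ a b * ((Real.log n / n) ^ (p / b) * (1 / Real.log n ^ 2)))) := by
  refine ⟨stabilityConst d p N, rateConst d p N, ?_⟩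
  rintro E _ _ _ X rfl a b r₀ π _ h n B hn hB Ω _ P S hS
  have : NeZero n := .of_pos hn
  have a_pos := h.a_pos
  have b_pos := h.b_pos
  have r₀_nonneg := h.r₀_nonneg
  have one_le_n : (1 : ℝ) ≤ n := by exact_mod_cast hn
  have q_nonneg : 0 ≤ p / b := by positivity
  have exp_le_one : Real.exp (-(a * n * r₀ ^ b / 2)) ≤ 1 :=
    Real.exp_le_one_iff.2 (neg_nonpos.2 (by positivity))
  have error_le {ρ : ℝ} := approximationError_le F d (zero_lt_one.trans_le hp) h
    (Nat.one_le_iff_ne_zero.1 hB) hS (ρ := ρ)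
  refine ⟨error_le (rpow_neg_mul_le_rpow_neg_sub_one q_nonneg one_le_n exp_le_one), fun hn => ?_,
    fun hn hr => ?_⟩
  · exact error_le (rpow_neg_mul_le_log_div_rpow (by positivity) (by gcongr)
      (by exact_mod_cast hn) exp_le_one)
  · exact error_le (rpow_neg_mul_le_log_div_rpow_mul q_nonneg (by exact_mod_cast hn)
      (exp_le_rpow_neg_half a_pos b_pos one_le_n hr))

theorem theorem4p3 {F : Type*} [Field F] (d : ℕ) (p : ℝ) (hp : 1 ≤ p) (N : ℕ) :
    ∃ (C₂ : ℝ) (C₃ : ℝ → ℝ → ℝ),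
      ∀ (m : ℕ) (X : Finset (EuclideanSpace ℝ (Fin m))), X.card = N →
        ∃ C₁ : ℝ, ∀ (a b r₀ : ℝ) (π : Measure X) [IsProbabilityMeasure π],
          MeanPersistence.StandardAssumption π a b r₀ →
          ∀ (n B : ℕ), 1 ≤ n → 1 ≤ B →
          ∀ {Ω : Type*} [MeasurableSpace Ω] (P : Measure Ω) [IsProbabilityMeasure P]
            (S : Fin B → Ω → Fin n → X), iIndepFun S P →
            (∀ i, HasLaw (S i) (Measure.pi fun _ : Fin n => π) P) →
            (b < p →
              MeanPersistence.approximationError F d p X P S ≤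
                ENNReal.ofReal (C₁ * (B : ℝ) ^ (-(1 / 2) : ℝ) + C₂ * r₀ ^ p
                  + C₃ a b * (n : ℝ) ^ (-(p / b - 1)))) ∧
            (p ≤ b → 2 ≤ n → r₀ < (Real.log n / (a * n)) ^ (1 / b) →
              MeanPersistence.approximationError F d p X P S ≤
                ENNReal.ofReal (C₁ * (B : ℝ) ^ (-(1 / 2) : ℝ) + C₂ * r₀ ^ p
                  + C₃ a b * (Real.log n / n) ^ (1 / b))) ∧
            (p ≤ b → 2 ≤ n → (Real.log n / (a * n)) ^ (1 / b) ≤ r₀ →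
              MeanPersistence.approximationError F d p X P S ≤
                ENNReal.ofReal (C₁ * (B : ℝ) ^ (-(1 / 2) : ℝ) + C₂ * r₀ ^ p
                  + C₃ a b * ((Real.log n / n) ^ (p / b) * (1 / Real.log n ^ 2)))) := by
  obtain ⟨C₂, C₃, error_le⟩ := theorem4p3_general (F := F) d p hp N
  refine ⟨C₂, C₃, fun m X hX => ⟨0, fun a b r₀ π _ h n B hn hB Ω _ P _ S _ hS => ?_⟩⟩
  simpa only [zero_mul, zero_add] using (error_le X hX a b r₀ π h n B hn hB P S hS).imp
    (fun fast _ => fast) (.imp (fun slow _ hn _ => slow hn) fun slow _ => slow)
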